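/- Consider a unicycle vehicle in the plane $\mathbb{R}^2\cong\mathbb{C}$ with a landmark at the origin $O_W$. In polar coordinates $(\rho,\psi)$ of its centre, $\rho>0$, and with the bearing $\beta$ (the angle between the heading and the direction of the landmark), its kinematics are $$\dot\rho=-\nu\cos\beta,\qquad \dot\psi=\frac{\sin\beta}{\rho}\,\nu,\qquad \dot\beta=\frac{\sin\beta}{\rho}\,\nu-\omega,$$ where the measurable controls (forward and angular velocity) satisfy $(\nu,\omega)\in U$ for a compact convex set $U\subset\mathbb{R}^2$ containing the origin in its interior, and solutions are absolutely continuous and satisfy the equations almost everywhere. A limited range sensor of aperture $\delta$, $0<\delta\le\pi/2$, whose axis makes an angle $\Gamma$, $0\le\Gamma\le\pi/2$, with the forward direction, must keep the landmark in sight: $\phi_1\le\beta\le\phi_2$, where $\phi_1=\Gamma-\delta/2$ and $\phi_2=\Gamma+\delta/2$. A feasible path from $Q$ to $P$ is a continuous curve $\gamma:[0,1]\to\mathbb{R}^2$ with $\gamma(0)=Q$ and $\gamma(1)=P$ such that every arc $\gamma|_{[a,b]}$ that avoids $O_W$ is, up to a monotone change of parameter (which may pause, so that the vehicle can rotate on the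 spot), covered by the centre of the vehicle during a finite-time motion with $\rho>0$ that satisfies the kinematic equations, the control constraint and the sensor constraint. The initial and final headings are free, and a path may pass through $O_W$, where the bearing is undefined and no constraint is imposed (so a path may for instance follow a logarithmic spiral into or out of $O_W$). Let $\rho_P>0$, let $P$ be the point with polar coordinates $(\rho_P,0)$, and let $C(P)$ be the circle with centre $O_W$ and radius $\rho_P$. **Proposition.** For every $Q\in C(P)$ there exists a feasible path from $Q$ to $P$ of finite length whose length is less than or equal to the length of every feasible path from $Q$ to $P$. -/

import Mathlib

open Set MeasureTheory

/-- The point of the plane of motion (identified with `ℂ`, the feature `O_W` being `0`) with polar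
coordinates `(ρ, ψ)`. -/
noncomputable def polarPoint (ρ ψ : ℝ) : ℂ := (ρ : ℂ) * Complex.exp ((ψ : ℂ) * Complex.I)

/-- A motion of the unicycle over the time interval `[0, T]` that stays away from the feature and
is feasible: measurable controls `(ν, ω)` (forward and angular velocity) with values in `U`,
absolutely continuous polar coordinates `(ρ, ψ, β)` with `ρ > 0` that solve the kinematic equations
almost everywhere, and bearing `β` (the angle between the heading and the direction of the feature)
within the sensor cone `[φ₁, φ₂]` at all times. -/
structure IsFeasibleMotion (U : Set (ℝ × ℝ)) (φ₁ φ₂ T : ℝ) (ρ ψ β ν ω : ℝ → ℝ) : Prop where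
  duration_nonneg : 0 ≤ T
  measurable_forward : Measurable ν
  measurable_angular : Measurable ω
  controls_mem : ∀ t ∈ Icc 0 T, (ν t, ω t) ∈ U
  absCont_rho : AbsolutelyContinuousOnInterval ρ 0 T
  absCont_psi : AbsolutelyContinuousOnInterval ψ 0 T
  absCont_beta : AbsolutelyContinuousOnInterval β 0 T
  rho_pos : ∀ t ∈ Icc 0 T, 0 < ρ t
  deriv_rho : ∀ᵐ t, t ∈ Ioo 0 T → HasDerivAt ρ (-Real.cos (β t) * ν t) t
  deriv_psi : ∀ᵐ t, t ∈ Ioo 0 T → HasDerivAt ψ (Real.sin (β t) / ρ t * ν t) t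
  deriv_beta : ∀ᵐ t, t ∈ Ioo 0 T → HasDerivAt β (Real.sin (β t) / ρ t * ν t - ω t) t
  sensor_right : ∀ t ∈ Icc 0 T, 0 ≤ β t - φ₁
  sensor_left : ∀ t ∈ Icc 0 T, β t - φ₂ ≤ 0

/-- The part of the curve `γ` over the parameter interval `[a, b]` is the path covered by the centre
of the vehicle during some feasible motion. The monotone time change `σ` may pause, so that the
vehicle can rotate on the spot. -/
def IsExecutable (U : Set (ℝ × ℝ)) (φ₁ φ₂ : ℝ) (γ : ℝ → ℂ) (a b : ℝ) : Prop :=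
  ∃ (T : ℝ) (ρ ψ β ν ω σ : ℝ → ℝ), IsFeasibleMotion U φ₁ φ₂ T ρ ψ β ν ω ∧
    ContinuousOn σ (Icc 0 T) ∧ MonotoneOn σ (Icc 0 T) ∧ σ 0 = a ∧ σ T = b ∧
    ∀ t ∈ Icc 0 T, polarPoint (ρ t) (ψ t) = γ (σ t)

/-- A feasible path from `Q` to `P`, parameterized by `[0, 1]`: a continuous curve in the plane each
of whose arcs that avoids the feature is covered by a feasible motion. The bearing is undefined when
the centre of the vehicle is exactly at the feature, so a path may pass through the feature and no
constraint is imposed there; in particular a logarithmic spiral may end or start at the feature. -/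
structure IsFeasiblePath (U : Set (ℝ × ℝ)) (φ₁ φ₂ : ℝ) (Q P : ℂ) (γ : ℝ → ℂ) : Prop where
  continuousOn : ContinuousOn γ (Icc 0 1)
  source : γ 0 = Q
  target : γ 1 = P
  executable : ∀ a b : ℝ, 0 ≤ a → a ≤ b → b ≤ 1 → (∀ s ∈ Icc a b, γ s ≠ 0) →
    IsExecutable U φ₁ φ₂ γ a b

/-- The length of a path parameterized by `[0, 1]` (possibly infinite). -/
noncomputable def pathLength (γ : ℝ → ℂ) : ENNReal := eVariationOn γ (Icc 0 1)

/-! The speed of the vehicle is `|ν|`, so only the directions permitted by the cone matter for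
length; slowing a motion down makes its controls fit into any neighbourhood of the origin. Existence
is proved by calibration, not by compactness of a space of paths: an explicit lower bound is matched
by an explicit path.

Lower bound. A function `c ψ - G ρ` whose differential is at most one on all permitted unit
directions varies at most by the length (`IsFeasibleMotion.ofReal_calibration_le`). In the variable
`s = c / ρ` put `G ρ = ρ Φ(s)`; the covector is then `(Φ - s Φ', s)`, and it has to be bounded for
`s ≤ S` only. A motion from distance `R` back to `R` is cut at its closest approach `r`; with `c = r
S`, one potential handles one half and a potential for the mirrored cone the other. The sum of the
estimates is `R * dualLength S Φ Φ' d p`, where `p = r S / R` and `d` is the angular displacement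
(`IsFeasibleMotion.exists_ofReal_le`). A path through the feature is bounded by its radial variation
(`IsFeasiblePath.ofReal_le_of_eq_zero`).

Attainment. The potentials are glued from those of logarithmic spirals and straight lines, along
which the calibration is sharp (`isExtremalPair_front`, `isExtremalPair_lateral`). Minimize the dual
length over `(0, S]`. At an interior minimizer the vanishing derivative says exactly that the inward
and outward extremals of momentum `R p` join up with displacement `d`; at `p = S` the path is a
circular arc (`IsExtremalPair.reach_of_isMin`). If the infimum is only approached as `p → 0`, its
value is the length of two spirals (or segments) meeting at the feature
(`isFeasiblePath_spiralPath`). -/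

/-! ### Absolutely continuous functions and arc length -/

theorem AbsolutelyContinuousOnInterval.comp_lipschitzOnWith {f g : ℝ → ℝ} {a b : ℝ} {K : NNReal}
    {S : Set ℝ} (hf : AbsolutelyContinuousOnInterval f a b) (hg : LipschitzOnWith K g S)
    (hS : MapsTo f (uIcc a b) S) : AbsolutelyContinuousOnInterval (fun t => g (f t)) a b := by
  rw [absolutelyContinuousOnInterval_iff] at hf ⊢
  intro ε hε
  obtain ⟨η, hη, h⟩ := hf (ε / (K + 1)) (by positivity)
  refine ⟨η, hη, fun E hE hsum => ?_⟩
  have h1 := h E hE hsum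
  calc
    _ ≤ ∑ i ∈ Finset.range E.1, K * dist (f (E.2 i).1) (f (E.2 i).2) :=
      Finset.sum_le_sum fun i hi =>
        hg.dist_le_mul _ (hS (hE.left i hi).left) _ (hS (hE.left i hi).right)
    _ = K * ∑ i ∈ Finset.range E.1, dist (f (E.2 i).1) (f (E.2 i).2) :=
      (Finset.mul_sum _ _ _).symm
    _ ≤ K * (ε / (K + 1)) := by gcongr
    _ < (K + 1) * (ε / (K + 1)) := by gcongr; linarith
    _ = ε := by field

theorem norm_le_of_hasDerivAt_of_dist_le {z : ℝ → ℂ} {s : ℝ → ℝ} {z' : ℂ} {s' t b : ℝ}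
    (htb : t < b) (hz : HasDerivAt z z' t) (hs : HasDerivAt s s' t)
    (h : ∀ y ∈ Ioo t b, ‖z y - z t‖ ≤ s y - s t) : ‖z'‖ ≤ s' := by
  have hz1 := (hasDerivWithinAt_iff_tendsto_slope' (s := Ioi t) (by simp)).1 hz.hasDerivWithinAt
  have hs1 := (hasDerivWithinAt_iff_tendsto_slope' (s := Ioi t) (by simp)).1 hs.hasDerivWithinAt
  refine le_of_tendsto_of_tendsto hz1.norm hs1 ?_
  filter_upwards [Ioo_mem_nhdsGT htb] with y hy
  have hpos : 0 < y - t := sub_pos.2 hy.1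
  simp only [slope, vsub_eq_sub, norm_smul, smul_eq_mul, norm_inv, Real.norm_eq_abs,
    abs_of_pos hpos]
  exact mul_le_mul_of_nonneg_left (h y hy) (by positivity)

/-- An absolutely continuous function whose derivative is dominated by the speed of a curve grows
at most by the length of the curve. -/
theorem ofReal_sub_le_eVariationOn {f : ℝ → ℝ} {z : ℝ → ℂ} {a b : ℝ} (hab : a ≤ b)
    (hf : AbsolutelyContinuousOnInterval f a b)
    (h : ∀ᵐ t, t ∈ Ioo a b → ∃ (f' : ℝ) (z' : ℂ),
      HasDerivAt f f' t ∧ HasDerivAt z z' t ∧ f' ≤ ‖z'‖) :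
    ENNReal.ofReal (f b - f a) ≤ eVariationOn z (Icc a b) := by
  by_cases hfin : eVariationOn z (Icc a b) = ⊤
  · simp [hfin]
  set s : ℝ → ℝ := fun t => (eVariationOn z (Icc a t)).toReal with hs
  have hfin' : ∀ t ≤ b, eVariationOn z (Icc a t) ≠ ⊤ := fun t ht =>
    ne_top_of_le_ne_top hfin (eVariationOn.mono _ (Icc_subset_Icc_right ht))
  have hdist : ∀ x y, a ≤ x → x ≤ y → y ≤ b → ‖z y - z x‖ ≤ s y - s x := by
    intro x y hax hxy hyb
    have h1 := eVariationOn.Icc_add_Icc z (s := univ) hax hxy (mem_univ _)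
    simp only [univ_inter] at h1
    have hxyf : eVariationOn z (Icc x y) ≠ ⊤ :=
      ne_top_of_le_ne_top hfin (eVariationOn.mono _ (Icc_subset_Icc hax hyb))
    have h2 : s y = s x + (eVariationOn z (Icc x y)).toReal := by
      rw [hs]; dsimp only
      rw [← h1, ENNReal.toReal_add (hfin' x (hxy.trans hyb)) hxyf]
    have h3 := eVariationOn.edist_le z (s := Icc x y) (right_mem_Icc.2 hxy) (left_mem_Icc.2 hxy)
    have h4 := ENNReal.toReal_mono hxyf h3
    rw [← dist_edist, dist_eq_norm] at h4
    linarith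
  have hmono : MonotoneOn s (Icc a b) := fun x hx y hy hxy => by
    have := hdist x y hx.1 hxy hy.2
    linarith [norm_nonneg (z y - z x)]
  -- The arc length `s` is monotone, and for a monotone function this inequality holds without
  -- absolute continuity; it points in the direction needed.
  have hsint : ∫ x in a..b, deriv s x ≤ s b - s a := by
    have h1 := MonotoneOn.intervalIntegral_deriv_mem_uIcc (f := s) (a := a) (b := b)
      (by rwa [uIcc_of_le hab])
    have h0 : 0 ≤ s b - s a :=
      sub_nonneg.2 (hmono (left_mem_Icc.2 hab) (right_mem_Icc.2 hab) hab)
    rw [uIcc_of_le h0] at h1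
    exact h1.2
  have hsd : ∀ᵐ t, t ∈ Ioo a b → DifferentiableAt ℝ s t := by
    have h1 := (hmono.mono Ioo_subset_Icc_self).ae_differentiableWithinAt measurableSet_Ioo
    rw [ae_restrict_iff' measurableSet_Ioo] at h1
    filter_upwards [h1] with t ht hm
    exact (ht hm).differentiableAt (Ioo_mem_nhds hm.1 hm.2)
  have hle : ∫ x in a..b, deriv f x ≤ ∫ x in a..b, deriv s x := by
    refine intervalIntegral.integral_mono_ae_restrict hab hf.intervalIntegrable_deriv
      (MonotoneOn.intervalIntegrable_deriv (by rwa [uIcc_of_le hab])) ?_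
    rw [Filter.EventuallyLE, ← Measure.restrict_congr_set Ioo_ae_eq_Icc,
      ae_restrict_iff' measurableSet_Ioo]
    filter_upwards [h, hsd] with t ht hst hm
    obtain ⟨f', z', hf', hz', hle⟩ := ht hm
    rw [hf'.deriv]
    exact hle.trans (norm_le_of_hasDerivAt_of_dist_le hm.2 hz' (hst hm).hasDerivAt
      fun y hy => hdist t y hm.1.le hy.1.le hy.2.le)
  rw [hf.integral_deriv_eq_sub] at hle
  have hsa : s a = 0 := by simp [hs, eVariationOn.subsingleton]
  rw [← ENNReal.ofReal_toReal hfin]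
  exact ENNReal.ofReal_le_ofReal (by linarith [hsint, hsa, show s b = _ from rfl])

theorem hasDerivAt_polarPoint {ρ ψ : ℝ → ℝ} {ρ' ψ' t : ℝ} (hρ : HasDerivAt ρ ρ' t)
    (hψ : HasDerivAt ψ ψ' t) :
    HasDerivAt (fun t => polarPoint (ρ t) (ψ t))
      ((ρ' + ρ t * ψ' * Complex.I) * Complex.exp (ψ t * Complex.I)) t := by
  unfold polarPoint
  have h1 := hρ.ofReal_comp.mul ((hψ.ofReal_comp.mul_const Complex.I).cexp)
  refine h1.congr_deriv ?_
  ring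

theorem norm_polarPoint (ρ ψ : ℝ) : ‖polarPoint ρ ψ‖ = |ρ| := by
  simp [polarPoint, Complex.norm_exp_ofReal_mul_I]

/-- The radial and transverse velocities are `-ν cos β` and `ν sin β`; the angular velocity `ω` does
not contribute to length. -/
theorem norm_velocity {ρ β ν ψ : ℝ} (hρ : 0 < ρ) :
    ‖(((-Real.cos β * ν : ℝ) : ℂ) + (ρ : ℂ) * ((Real.sin β / ρ * ν : ℝ) : ℂ) * Complex.I) *
      Complex.exp ((ψ : ℂ) * Complex.I)‖ = |ν| := by
  rw [norm_mul, Complex.norm_exp_ofReal_mul_I, mul_one]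
  have : (((-Real.cos β * ν : ℝ) : ℂ) + (ρ : ℂ) * ((Real.sin β / ρ * ν : ℝ) : ℂ) * Complex.I)
      = ((-Real.cos β * ν : ℝ) : ℂ) + ((Real.sin β * ν : ℝ) : ℂ) * Complex.I := by
    have : (ρ : ℂ) ≠ 0 := by exact_mod_cast hρ.ne'
    push_cast; field_simp
  rw [this, Complex.norm_add_mul_I]
  rw [show (-Real.cos β * ν) ^ 2 + (Real.sin β * ν) ^ 2 = ν ^ 2 by
    nlinarith [Real.sin_sq_add_cos_sq β]]
  exact Real.sqrt_sq_eq_abs ν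

/-! ### Calibrations and the lower bound for motions -/

/-- Calibration: a function `c ψ - G ρ` whose derivative along every admissible direction is at
most one in absolute value varies at most by the length of a feasible motion. -/
theorem IsFeasibleMotion.ofReal_calibration_le {U : Set (ℝ × ℝ)} {φ₁ φ₂ T : ℝ}
    {ρ ψ β ν ω : ℝ → ℝ} (hm : IsFeasibleMotion U φ₁ φ₂ T ρ ψ β ν ω) {t₀ t₁ : ℝ} (h0 : 0 ≤ t₀)
    (h01 : t₀ ≤ t₁) (h1 : t₁ ≤ T) {c : ℝ} {G g : ℝ → ℝ} {r M : ℝ}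
    (hr : ∀ t ∈ Icc t₀ t₁, r ≤ ρ t)
    (hG : ∀ x, r ≤ x → HasDerivAt G (g x) x) (hgM : ∀ x, r ≤ x → |g x| ≤ M)
    (hcal : ∀ x, r ≤ x → ∀ b, φ₁ ≤ b → b ≤ φ₂ → |g x * Real.cos b + c / x * Real.sin b| ≤ 1) :
    ENNReal.ofReal |(c * ψ t₁ - G (ρ t₁)) - (c * ψ t₀ - G (ρ t₀))| ≤
      eVariationOn (fun t => polarPoint (ρ t) (ψ t)) (Icc t₀ t₁) := by
  have hT := hm.duration_nonneg
  have hsub : uIcc t₀ t₁ ⊆ uIcc 0 T := by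
    rw [uIcc_of_le h01, uIcc_of_le hT]; exact Icc_subset_Icc h0 h1
  have hLip : LipschitzOnWith (Real.toNNReal M) G (Ici r) := by
    refine (convex_Ici r).lipschitzOnWith_of_nnnorm_hasDerivWithin_le
      (fun x hx => (hG x hx).hasDerivWithinAt) fun x hx => ?_
    rw [← NNReal.coe_le_coe, coe_nnnorm, Real.norm_eq_abs]
    exact (hgM x hx).trans (Real.le_coe_toNNReal M)
  have hAC : AbsolutelyContinuousOnInterval (fun t => c * ψ t - G (ρ t)) t₀ t₁ := by
    have e1 := (hm.absCont_psi.mono hsub).const_mul c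
    have e2 := (hm.absCont_rho.mono hsub).comp_lipschitzOnWith hLip (by
      rw [uIcc_of_le h01]; exact fun t ht => hr t ht)
    exact e1.fun_sub e2
  have key : ∀ᵐ t, t ∈ Ioo t₀ t₁ → ∃ (f' : ℝ) (z' : ℂ),
      HasDerivAt (fun t => c * ψ t - G (ρ t)) f' t ∧
      HasDerivAt (fun t => polarPoint (ρ t) (ψ t)) z' t ∧ |f'| ≤ ‖z'‖ := by
    filter_upwards [hm.deriv_rho, hm.deriv_psi] with t hρ hψ ht
    have htT : t ∈ Ioo 0 T := ⟨h0.trans_lt ht.1, ht.2.trans_le h1⟩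
    have htI := Ioo_subset_Icc_self htT
    have hpos := hm.rho_pos t htI
    have hrt := hr t (Ioo_subset_Icc_self ht)
    refine ⟨_, _, ((hψ htT).const_mul c).sub ((hG _ hrt).comp t (hρ htT)),
      hasDerivAt_polarPoint (hρ htT) (hψ htT), ?_⟩
    rw [norm_velocity hpos]
    have e : c * (Real.sin (β t) / ρ t * ν t) - g (ρ t) * (-Real.cos (β t) * ν t)
        = (g (ρ t) * Real.cos (β t) + c / ρ t * Real.sin (β t)) * ν t := by ring
    rw [e, abs_mul]
    have := hcal _ hrt (β t) (by linarith [hm.sensor_right t htI])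
      (by linarith [hm.sensor_left t htI])
    nlinarith [abs_nonneg (ν t)]
  rcases le_total 0 ((c * ψ t₁ - G (ρ t₁)) - (c * ψ t₀ - G (ρ t₀))) with h | h
  · rw [abs_of_nonneg h]
    refine ofReal_sub_le_eVariationOn h01 hAC ?_
    filter_upwards [key] with t ht hm
    obtain ⟨f', z', a, b, d⟩ := ht hm
    exact ⟨f', z', a, b, (le_abs_self _).trans d⟩
  · rw [abs_of_nonpos h]
    have := ofReal_sub_le_eVariationOn (z := fun t => polarPoint (ρ t) (ψ t)) h01 hAC.fun_neg (by
      filter_upwards [key] with t ht hm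
      obtain ⟨f', z', a, b, d⟩ := ht hm
      exact ⟨-f', z', a.neg, b, (neg_le_abs _).trans d⟩)
    convert this using 2
    ring

/-- The data of a radial calibration written in the variable `s`, the quotient of the angular
momentum by the distance: `Φ` has derivative `T`, and the gradient `(Φ - s T, s)` has product at
most one with all admissible directions as long as `s ≤ S`. -/
structure IsCalibrating (φ₁ φ₂ S : ℝ) (Φ T : ℝ → ℝ) : Prop where
  deriv : ∀ s, 0 < s → HasDerivAt Φ (T s) s
  bound : ∀ s, 0 < s → s ≤ S → ∀ b, φ₁ ≤ b → b ≤ φ₂ →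
    |(Φ s - s * T s) * Real.cos b + s * Real.sin b| ≤ 1

theorem hasDerivAt_mul_comp_div {Φ T : ℝ → ℝ} (h : ∀ s, 0 < s → HasDerivAt Φ (T s) s) {P x : ℝ}
    (hP : 0 < P) (hx : 0 < x) :
    HasDerivAt (fun x => x * Φ (P / x)) (Φ (P / x) - P / x * T (P / x)) x := by
  have h1 : HasDerivAt (fun x => P / x) (-P / x ^ 2) x := by
    have := (hasDerivAt_const x P).fun_div (hasDerivAt_id' x) hx.ne'
    exact this.congr_deriv (by ring)
  have h2 := (hasDerivAt_id x).mul ((h (P / x) (by positivity)).comp x h1)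
  refine h2.congr_deriv ?_
  simp only [id, Function.comp]
  field_simp
  ring

/-- One bearing with positive cosine suffices to bound the radial coefficient uniformly. This
supplies the Lipschitz constant that keeps the calibrating function absolutely continuous along a
motion. -/
theorem IsCalibrating.abs_radial_le {φ₁ φ₂ S : ℝ} {Φ T : ℝ → ℝ} (h : IsCalibrating φ₁ φ₂ S Φ T) {b : ℝ}
    (h1 : φ₁ ≤ b) (h2 : b ≤ φ₂) (hcos : 0 < Real.cos b) {s : ℝ} (hs : 0 < s) (hsS : s ≤ S) :
    |Φ s - s * T s| ≤ (1 + S) / Real.cos b := by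
  have := abs_le.1 (h.bound s hs hsS b h1 h2)
  have : |s * Real.sin b| ≤ s := by
    rw [abs_mul, abs_of_pos hs]; exact mul_le_of_le_one_right hs.le (Real.abs_sin_le_one b)
  have := abs_le.1 this
  rw [le_div_iff₀ hcos, ← abs_of_pos hcos, ← abs_mul]
  exact abs_le.2 ⟨by linarith, by linarith⟩

/-- The momentum `r * S` is the largest for which `s = r * S / ρ` stays below `S` wherever `ρ ≥ r`.
The absolute value reflects that the vehicle may drive forwards and backwards. -/
theorem IsFeasibleMotion.ofReal_inward_le {U : Set (ℝ × ℝ)} {φ₁ φ₂ T : ℝ}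
    {ρ ψ β ν ω : ℝ → ℝ} (hm : IsFeasibleMotion U φ₁ φ₂ T ρ ψ β ν ω) {t₀ t₁ : ℝ} (h0 : 0 ≤ t₀)
    (h01 : t₀ ≤ t₁) (h1 : t₁ ≤ T) {r : ℝ} (hr0 : 0 < r) (hr : ∀ t ∈ Icc t₀ t₁, r ≤ ρ t)
    {S : ℝ} (hS : 0 < S) {Φ τ : ℝ → ℝ} (hΦ : IsCalibrating φ₁ φ₂ S Φ τ) (hφ : φ₁ ≤ φ₂)
    (hcos : 0 < Real.cos φ₁) :
    ENNReal.ofReal |r * S * (ψ t₁ - ψ t₀) -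
        (ρ t₁ * Φ (r * S / ρ t₁) - ρ t₀ * Φ (r * S / ρ t₀))| ≤
      eVariationOn (fun t => polarPoint (ρ t) (ψ t)) (Icc t₀ t₁) := by
  have hP : 0 < r * S := by positivity
  have hs : ∀ x, r ≤ x → 0 < r * S / x ∧ r * S / x ≤ S := fun x hx => by
    have : 0 < x := hr0.trans_le hx
    refine ⟨by positivity, ?_⟩
    rw [div_le_iff₀ this]; nlinarith
  have := hm.ofReal_calibration_le h0 h01 h1 (c := r * S) (G := fun x => x * Φ (r * S / x))
    (g := fun x => Φ (r * S / x) - r * S / x * τ (r * S / x)) (M := (1 + S) / Real.cos φ₁) hr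
    (fun x hx => hasDerivAt_mul_comp_div hΦ.deriv hP (hr0.trans_le hx))
    (fun x hx => hΦ.abs_radial_le le_rfl hφ hcos (hs x hx).1 (hs x hx).2)
    (fun x hx b hb1 hb2 => hΦ.bound _ (hs x hx).1 (hs x hx).2 b hb1 hb2)
  refine le_of_eq_of_le ?_ this
  congr 2; ring

/-- Reversing the sign of the radial coefficient amounts, up to a global sign, to replacing the
bearing `b` by `-b`; hence the potential must calibrate the mirrored cone. -/
theorem IsFeasibleMotion.ofReal_outward_le {U : Set (ℝ × ℝ)} {φ₁ φ₂ T : ℝ}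
    {ρ ψ β ν ω : ℝ → ℝ} (hm : IsFeasibleMotion U φ₁ φ₂ T ρ ψ β ν ω) {t₀ t₁ : ℝ} (h0 : 0 ≤ t₀)
    (h01 : t₀ ≤ t₁) (h1 : t₁ ≤ T) {r : ℝ} (hr0 : 0 < r) (hr : ∀ t ∈ Icc t₀ t₁, r ≤ ρ t)
    {S : ℝ} (hS : 0 < S) {Φ τ : ℝ → ℝ} (hΦ : IsCalibrating (-φ₂) (-φ₁) S Φ τ) (hφ : φ₁ ≤ φ₂)
    (hcos : 0 < Real.cos φ₁) :
    ENNReal.ofReal |r * S * (ψ t₁ - ψ t₀) +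
        (ρ t₁ * Φ (r * S / ρ t₁) - ρ t₀ * Φ (r * S / ρ t₀))| ≤
      eVariationOn (fun t => polarPoint (ρ t) (ψ t)) (Icc t₀ t₁) := by
  have hP : 0 < r * S := by positivity
  have hs : ∀ x, r ≤ x → 0 < r * S / x ∧ r * S / x ≤ S := fun x hx => by
    have : 0 < x := hr0.trans_le hx
    refine ⟨by positivity, ?_⟩
    rw [div_le_iff₀ this]; nlinarith
  have := hm.ofReal_calibration_le h0 h01 h1 (c := r * S) (G := fun x => -(x * Φ (r * S / x)))
    (g := fun x => -(Φ (r * S / x) - r * S / x * τ (r * S / x))) (M := (1 + S) / Real.cos φ₁) hr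
    (fun x hx => (hasDerivAt_mul_comp_div hΦ.deriv hP (hr0.trans_le hx)).neg)
    (fun x hx => by
      rw [abs_neg, ← Real.cos_neg φ₁]
      exact hΦ.abs_radial_le (by linarith) le_rfl (by rwa [Real.cos_neg]) (hs x hx).1 (hs x hx).2)
    (fun x hx b hb1 hb2 => by
      have := hΦ.bound _ (hs x hx).1 (hs x hx).2 (-b) (by linarith) (by linarith)
      rw [Real.cos_neg, Real.sin_neg, ← abs_neg] at this
      convert this using 2; ring)
  refine le_of_eq_of_le ?_ this
  congr 2; ring

/-- Lower bound for the length of a feasible motion that starts and ends at distance `R`. -/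
theorem IsFeasibleMotion.exists_ofReal_le {U : Set (ℝ × ℝ)} {φ₁ φ₂ T : ℝ}
    {ρ ψ β ν ω : ℝ → ℝ} (hm : IsFeasibleMotion U φ₁ φ₂ T ρ ψ β ν ω)
    {S : ℝ} (hS : 0 < S) {Φ τ Φ' τ' : ℝ → ℝ} (hΦ : IsCalibrating φ₁ φ₂ S Φ τ)
    (hΦ' : IsCalibrating (-φ₂) (-φ₁) S Φ' τ') (hφ : φ₁ ≤ φ₂) (hcos : 0 < Real.cos φ₁) {R : ℝ}
    (hR : 0 < R) (hρ0 : ρ 0 = R) (hρT : ρ T = R) :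
    ∃ p, 0 < p ∧ p ≤ S ∧
      ENNReal.ofReal (R * (p * |ψ T - ψ 0| + (Φ p + Φ' p) - p * ((Φ S + Φ' S) / S))) ≤
        eVariationOn (fun t => polarPoint (ρ t) (ψ t)) (Icc 0 T) := by
  have hT := hm.duration_nonneg
  have hcont : ContinuousOn ρ (Icc 0 T) := by
    have := hm.absCont_rho.continuousOn
    rwa [uIcc_of_le hT] at this
  -- The motion is cut at its closest approach; both halves then stay at distance at least `ρ t`.
  obtain ⟨t, ht, hmin⟩ := isCompact_Icc.exists_isMinOn (nonempty_Icc.2 hT) hcont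
  rw [isMinOn_iff] at hmin
  have hr0 := hm.rho_pos t ht
  have hrR : ρ t ≤ R := hρ0 ▸ hmin 0 (left_mem_Icc.2 hT)
  have hl : ∀ u ∈ Icc 0 t, ρ t ≤ ρ u := fun u hu => hmin u ⟨hu.1, hu.2.trans ht.2⟩
  have hr : ∀ u ∈ Icc t T, ρ t ≤ ρ u := fun u hu => hmin u ⟨ht.1.trans hu.1, hu.2⟩
  have e : ρ t * S / ρ t = S := by field_simp
  have hadd := eVariationOn.Icc_add_Icc (fun t => polarPoint (ρ t) (ψ t)) (s := univ) ht.1 ht.2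
    (mem_univ _)
  simp only [univ_inter] at hadd
  refine ⟨ρ t * S / R, by positivity, by rw [div_le_iff₀ hR]; nlinarith, ?_⟩
  rw [← hadd]
  set p := ρ t * S / R with hp
  have hpe : R * (p * ((Φ S + Φ' S) / S)) = ρ t * (Φ S + Φ' S) := by rw [hp]; field_simp
  have hpR : R * p = ρ t * S := by rw [hp]; field_simp
  -- If the polar angle decreases overall, the two calibrations exchange their halves and are used
  -- with the opposite sign.
  rcases le_total 0 (ψ T - ψ 0) with h | h
  · have i1 := hm.ofReal_inward_le le_rfl ht.1 ht.2 hr0 hl hS hΦ hφ hcos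
    have i2 := hm.ofReal_outward_le ht.1 ht.2 le_rfl hr0 hr hS hΦ' hφ hcos
    refine le_trans ?_ (add_le_add i1 i2)
    rw [← ENNReal.ofReal_add (abs_nonneg _) (abs_nonneg _)]
    refine ENNReal.ofReal_le_ofReal (le_trans (le_of_eq ?_)
      (add_le_add (le_abs_self _) (le_abs_self _)))
    rw [abs_of_nonneg h, hρ0, hρT, e, ← hp, mul_sub, hpe]
    linear_combination (ψ T - ψ 0) * hpR
  · have i1 := hm.ofReal_outward_le le_rfl ht.1 ht.2 hr0 hl hS hΦ' hφ hcos
    have i2 := hm.ofReal_inward_le ht.1 ht.2 le_rfl hr0 hr hS hΦ hφ hcos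
    refine le_trans ?_ (add_le_add i1 i2)
    rw [← ENNReal.ofReal_add (abs_nonneg _) (abs_nonneg _)]
    refine ENNReal.ofReal_le_ofReal (le_trans (le_of_eq ?_)
      (add_le_add (neg_le_abs _) (neg_le_abs _)))
    rw [abs_of_nonpos h, hρ0, hρT, e, ← hp, mul_sub, hpe]
    linear_combination -(ψ T - ψ 0) * hpR

/-! ### Lower bounds for feasible paths -/

theorem IsFeasibleMotion.eVariationOn_le {U : Set (ℝ × ℝ)} {φ₁ φ₂ T : ℝ}
    {ρ ψ β ν ω σ : ℝ → ℝ} (_hm : IsFeasibleMotion U φ₁ φ₂ T ρ ψ β ν ω) {γ : ℝ → ℂ} {a b : ℝ}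
    (hσ : MonotoneOn σ (Icc 0 T)) (hσ0 : σ 0 = a) (hσT : σ T = b)
    (hγ : ∀ t ∈ Icc 0 T, polarPoint (ρ t) (ψ t) = γ (σ t)) :
    eVariationOn (fun t => polarPoint (ρ t) (ψ t)) (Icc 0 T) ≤ eVariationOn γ (Icc a b) := by
  rw [eVariationOn.congr (g := γ ∘ σ) hγ]
  refine eVariationOn.comp_le_of_monotoneOn γ σ hσ fun t ht => ?_
  have hT := ht.1.trans ht.2
  exact ⟨hσ0 ▸ hσ (left_mem_Icc.2 hT) ht ht.1, hσT ▸ hσ ht (right_mem_Icc.2 hT) ht.2⟩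

/-- The calibration with `c = 0`: the distance changes at rate at most `C` per unit length. -/
theorem IsExecutable.ofReal_norm_sub_le {U : Set (ℝ × ℝ)} {φ₁ φ₂ : ℝ} {γ : ℝ → ℂ} {a b : ℝ}
    (h : IsExecutable U φ₁ φ₂ γ a b) {C : ℝ} (hC : 0 < C)
    (hcos : ∀ x, φ₁ ≤ x → x ≤ φ₂ → |Real.cos x| ≤ C) :
    ENNReal.ofReal (|‖γ b‖ - ‖γ a‖| / C) ≤ eVariationOn γ (Icc a b) := by
  obtain ⟨T, ρ, ψ, β, ν, ω, σ, hm, -, hσ, hσ0, hσT, hγ⟩ := h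
  have hT := hm.duration_nonneg
  refine le_trans ?_ (hm.eVariationOn_le hσ hσ0 hσT hγ)
  have h0 := hγ 0 (left_mem_Icc.2 hT)
  have h1 := hγ T (right_mem_Icc.2 hT)
  rw [hσ0] at h0; rw [hσT] at h1
  rw [← h0, ← h1, norm_polarPoint, norm_polarPoint, abs_of_pos (hm.rho_pos 0 (left_mem_Icc.2 hT)),
    abs_of_pos (hm.rho_pos T (right_mem_Icc.2 hT))]
  have := hm.ofReal_calibration_le le_rfl hT le_rfl (c := 0) (G := fun x => x / C)
    (g := fun _ => 1 / C) (r := 0) (M := 1 / C) (fun t ht => (hm.rho_pos t ht).le)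
    (fun x _ => (hasDerivAt_id x).div_const C) (fun x _ => by rw [abs_of_pos (by positivity)])
    (fun x _ b hb1 hb2 => by
      have := hcos b hb1 hb2
      rw [zero_div, zero_mul, add_zero, abs_mul, abs_of_pos (by positivity), one_div,
        ← div_eq_inv_mul, div_le_one hC]
      exact this)
  refine le_of_eq_of_le ?_ this
  congr 1
  rw [show (0 * ψ T - ρ T / C) - (0 * ψ 0 - ρ 0 / C) = -((ρ T - ρ 0) / C) by ring, abs_neg, abs_div,
    abs_of_pos hC]

/-- Lower bound for the length of a feasible path through the feature. -/
theorem IsFeasiblePath.ofReal_le_of_eq_zero {U : Set (ℝ × ℝ)} {φ₁ φ₂ : ℝ} {Q P : ℂ} {γ : ℝ → ℂ}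
    (h : IsFeasiblePath U φ₁ φ₂ Q P γ) {C R : ℝ} (hC : 0 < C) (hR : 0 < R)
    (hcos : ∀ x, φ₁ ≤ x → x ≤ φ₂ → |Real.cos x| ≤ C) (hQ : ‖Q‖ = R) (hP : ‖P‖ = R)
    (hz : ∃ s ∈ Icc (0 : ℝ) 1, γ s = 0) :
    ENNReal.ofReal (2 * R / C) ≤ pathLength γ := by
  -- Only the arcs before the first and after the last visit to the feature are counted.
  -- Executability holds on compact arcs away from the feature, so each estimate is a limit.
  set Z : Set ℝ := {s ∈ Icc (0 : ℝ) 1 | γ s = 0} with hZ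
  have hZc : IsCompact Z := by
    have := h.continuousOn.preimage_isClosed_of_isClosed isClosed_Icc (isClosed_singleton (x := 0))
    exact isCompact_Icc.of_isClosed_subset this fun s hs => hs.1
  have hZn : Z.Nonempty := hz
  obtain ⟨a, ha, hamin⟩ := hZc.exists_isLeast hZn
  obtain ⟨b, hb, hbmax⟩ := hZc.exists_isGreatest hZn
  have hab : a ≤ b := hamin hb
  have ha0 : 0 < a := lt_of_le_of_ne ha.1.1 (fun h0 => by
    have := ha.2; rw [← h0, h.source] at this; rw [this] at hQ; simp at hQ; linarith)
  have hb1 : b < 1 := lt_of_le_of_ne hb.1.2 (fun h0 => by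
    have := hb.2; rw [h0, h.target] at this; rw [this] at hP; simp at hP; linarith)
  have hlim : ∀ x ∈ Icc (0 : ℝ) 1, γ x = 0 →
      Filter.Tendsto (fun s => ENNReal.ofReal (|R - ‖γ s‖| / C)) (nhdsWithin x (Icc 0 1))
        (nhds (ENNReal.ofReal (R / C))) := by
    intro x hx hx0
    have h1 : Filter.Tendsto (fun s => |R - ‖γ s‖| / C) (nhdsWithin x (Icc 0 1))
        (nhds (|R - ‖γ x‖| / C)) :=
      (((h.continuousOn x hx).norm.const_sub R).abs).div_const C
    rw [hx0, norm_zero, sub_zero, abs_of_pos hR] at h1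
    exact ENNReal.tendsto_ofReal h1
  have hleft : ENNReal.ofReal (R / C) ≤ eVariationOn γ (Icc 0 a) := by
    have hne : (nhdsWithin a (Ioo 0 a)).NeBot := by
      rw [← mem_closure_iff_nhdsWithin_neBot, closure_Ioo ha0.ne]; exact right_mem_Icc.2 ha0.le
    have := (hlim a ha.1 ha.2).mono_left (nhdsWithin_mono a
      (show Ioo 0 a ⊆ Icc 0 1 from fun s hs => ⟨hs.1.le, hs.2.le.trans ha.1.2⟩))
    refine le_of_tendsto this ?_
    filter_upwards [self_mem_nhdsWithin] with s hs
    have hex := h.executable 0 s le_rfl hs.1.le (hs.2.le.trans ha.1.2) fun u hu hu0 =>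
      absurd (hamin ⟨⟨hu.1, hu.2.trans (hs.2.le.trans ha.1.2)⟩, hu0⟩)
        (not_le.2 (hu.2.trans_lt hs.2))
    have := hex.ofReal_norm_sub_le hC hcos
    rw [h.source, hQ, abs_sub_comm] at this
    exact this.trans (eVariationOn.mono _ (Icc_subset_Icc_right hs.2.le))
  have hright : ENNReal.ofReal (R / C) ≤ eVariationOn γ (Icc b 1) := by
    have hne : (nhdsWithin b (Ioo b 1)).NeBot := by
      rw [← mem_closure_iff_nhdsWithin_neBot, closure_Ioo hb1.ne]; exact left_mem_Icc.2 hb1.le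
    have := (hlim b hb.1 hb.2).mono_left (nhdsWithin_mono b
      (show Ioo b 1 ⊆ Icc 0 1 from fun s hs => ⟨hb.1.1.trans hs.1.le, hs.2.le⟩))
    refine le_of_tendsto this ?_
    filter_upwards [self_mem_nhdsWithin] with s hs
    have hex := h.executable s 1 (hb.1.1.trans hs.1.le) hs.2.le le_rfl fun u hu hu0 =>
      absurd (hbmax ⟨⟨hb.1.1.trans (hs.1.le.trans hu.1), hu.2⟩, hu0⟩)
        (not_le.2 (hs.1.trans_le hu.1))
    have := hex.ofReal_norm_sub_le hC hcos
    rw [h.target, hP] at this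
    exact this.trans (eVariationOn.mono _ (Icc_subset_Icc_left hs.1.le))
  calc ENNReal.ofReal (2 * R / C) = ENNReal.ofReal (R / C) + ENNReal.ofReal (R / C) := by
        rw [← ENNReal.ofReal_add (by positivity) (by positivity)]; congr 1; ring
    _ ≤ eVariationOn γ (Icc 0 a) + eVariationOn γ (Icc b 1) := add_le_add hleft hright
    _ ≤ eVariationOn γ (Icc 0 a ∪ Icc b 1) :=
        eVariationOn.add_le_union _ fun x hx y hy => hx.2.trans (hab.trans hy.1)
    _ ≤ pathLength γ := eVariationOn.mono _ (union_subset (Icc_subset_Icc_right ha.1.2)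
        (Icc_subset_Icc_left hb.1.1))

theorem exists_int_of_polarPoint_eq {R a b : ℝ} (hR : 0 < R)
    (h : polarPoint R a = polarPoint R b) : ∃ n : ℤ, a = b + n * (2 * Real.pi) := by
  unfold polarPoint at h
  have hR' : (R : ℂ) ≠ 0 := by exact_mod_cast hR.ne'
  obtain ⟨n, hn⟩ := Complex.exp_eq_exp_iff_exists_int.1 (mul_left_cancel₀ hR' h)
  refine ⟨n, ?_⟩
  have : ((a : ℂ) - (b + n * (2 * Real.pi))) * Complex.I = 0 := by linear_combination hn
  rcases mul_eq_zero.1 this with h | h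
  · have : ((a - (b + n * (2 * Real.pi)) : ℝ) : ℂ) = 0 := by push_cast; exact h
    linarith [Complex.ofReal_eq_zero.1 this]
  · exact absurd h Complex.I_ne_zero

/-- Lower bound for the length of a feasible path that avoids the feature. -/
theorem IsFeasiblePath.exists_ofReal_le {U : Set (ℝ × ℝ)} {φ₁ φ₂ : ℝ} {γ : ℝ → ℂ} {R θ : ℝ}
    (hR : 0 < R) (hθ : |θ| ≤ Real.pi)
    (h : IsFeasiblePath U φ₁ φ₂ (polarPoint R θ) (polarPoint R 0) γ)
    {S : ℝ} (hS : 0 < S) {Φ τ Φ' τ' : ℝ → ℝ} (hΦ : IsCalibrating φ₁ φ₂ S Φ τ)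
    (hΦ' : IsCalibrating (-φ₂) (-φ₁) S Φ' τ') (hφ : φ₁ ≤ φ₂) (hcos : 0 < Real.cos φ₁)
    (hz : ∀ s ∈ Icc (0 : ℝ) 1, γ s ≠ 0) :
    ∃ p, 0 < p ∧ p ≤ S ∧
      ENNReal.ofReal (R * (p * |θ| + (Φ p + Φ' p) - p * ((Φ S + Φ' S) / S))) ≤ pathLength γ := by
  obtain ⟨T, ρ, ψ, β, ν, ω, σ, hm, -, hσ, hσ0, hσT, hγ⟩ :=
    h.executable 0 1 le_rfl zero_le_one le_rfl hz
  have hT := hm.duration_nonneg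
  have h0 := hγ 0 (left_mem_Icc.2 hT)
  have h1 := hγ T (right_mem_Icc.2 hT)
  rw [hσ0, h.source] at h0; rw [hσT, h.target] at h1
  have hρ0 : ρ 0 = R := by
    have := congrArg norm h0
    rwa [norm_polarPoint, norm_polarPoint, abs_of_pos hR,
      abs_of_pos (hm.rho_pos 0 (left_mem_Icc.2 hT))] at this
  have hρT : ρ T = R := by
    have := congrArg norm h1
    rwa [norm_polarPoint, norm_polarPoint, abs_of_pos hR,
      abs_of_pos (hm.rho_pos T (right_mem_Icc.2 hT))] at this
  rw [hρ0] at h0; rw [hρT] at h1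
  obtain ⟨m, hm0⟩ := exists_int_of_polarPoint_eq hR h0
  obtain ⟨n, hn⟩ := exists_int_of_polarPoint_eq hR h1
  -- The continuous angle along the motion is determined modulo `2π` at each end; since `|θ| ≤ π`,
  -- winding cannot make its change smaller than `|θ|`.
  have hle : |θ| ≤ |ψ T - ψ 0| := by
    rcases eq_or_ne n m with rfl | hne
    · rw [hn, hm0, ← abs_neg θ]; apply le_of_eq; congr 1; ring
    · have h2 : (1 : ℝ) ≤ |(n - m : ℝ)| := by
        exact_mod_cast Int.one_le_abs (sub_ne_zero.2 hne)
      have h3 : ψ T - ψ 0 = (n - m) * (2 * Real.pi) - θ := by rw [hn, hm0]; ring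
      have h4 : 2 * Real.pi ≤ |(n - m : ℝ) * (2 * Real.pi)| := by
        rw [abs_mul, abs_of_pos Real.two_pi_pos]; nlinarith [Real.pi_pos]
      rw [h3]
      linarith [abs_sub_abs_le_abs_sub ((n - m : ℝ) * (2 * Real.pi)) θ]
  obtain ⟨p, hp0, hpS, hp⟩ := hm.exists_ofReal_le hS hΦ hΦ' hφ hcos hR hρ0 hρT
  refine ⟨p, hp0, hpS, le_trans (ENNReal.ofReal_le_ofReal ?_)
    (hp.trans (hm.eVariationOn_le hσ hσ0 hσT hγ))⟩
  have := mul_le_mul_of_nonneg_left hle hp0.le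
  exact mul_le_mul_of_nonneg_left (by linarith) hR.le

/-! ### Constructing motions: symmetries, concatenation, slowing down -/

/-- The right-hand side of the kinematic equations for the state `(ρ, ψ, β)`. -/
noncomputable def unicycleField (x : ℝ × ℝ × ℝ) (ν ω : ℝ) : ℝ × ℝ × ℝ :=
  (-Real.cos x.2.2 * ν, Real.sin x.2.2 / x.1 * ν, Real.sin x.2.2 / x.1 * ν - ω)

/-- The position of the centre of the vehicle in the state `(ρ, ψ, β)`. -/
noncomputable def statePoint (x : ℝ × ℝ × ℝ) : ℂ := polarPoint x.1 x.2.1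

/-- Motions with Lipschitz continuous state and controls bounded by `ε`, which solve the kinematic
equations outside a countable set of times. -/
structure IsDriven (ε φ₁ φ₂ T : ℝ) (x : ℝ → ℝ × ℝ × ℝ) (ν ω : ℝ → ℝ) : Prop where
  nonneg : 0 ≤ T
  measurable_forward : Measurable ν
  measurable_angular : Measurable ω
  forward_le : ∀ t ∈ Icc 0 T, |ν t| ≤ ε
  angular_le : ∀ t ∈ Icc 0 T, |ω t| ≤ ε
  lipschitz : ∃ K, LipschitzOnWith K x (Icc 0 T)
  pos : ∀ t ∈ Icc 0 T, 0 < (x t).1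
  cone : ∀ t ∈ Icc 0 T, (x t).2.2 ∈ Icc φ₁ φ₂
  deriv : ∃ N : Set ℝ, N.Countable ∧ ∀ t ∈ Ioo 0 T, t ∉ N →
    HasDerivAt x (unicycleField (x t) (ν t) (ω t)) t

namespace IsDriven

variable {ε φ₁ φ₂ T : ℝ} {x : ℝ → ℝ × ℝ × ℝ} {ν ω : ℝ → ℝ}

theorem isFeasibleMotion (h : IsDriven ε φ₁ φ₂ T x ν ω) {U : Set (ℝ × ℝ)}
    (hU : ∀ a b : ℝ, |a| ≤ ε → |b| ≤ ε → (a, b) ∈ U) :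
    IsFeasibleMotion U φ₁ φ₂ T (fun t => (x t).1) (fun t => (x t).2.1) (fun t => (x t).2.2)
      ν ω := by
  obtain ⟨K, hK⟩ := h.lipschitz
  obtain ⟨N, hN, hd⟩ := h.deriv
  rw [← uIcc_of_le h.nonneg] at hK
  have hae : ∀ᵐ t, t ∈ Ioo 0 T → HasDerivAt x (unicycleField (x t) (ν t) (ω t)) t := by
    filter_upwards [hN.ae_notMem volume] with t ht hm
    exact hd t hm ht
  have hK2 := LipschitzWith.prod_snd.comp_lipschitzOnWith hK
  have hsnd : ∀ {t : ℝ} {y : ℝ × ℝ × ℝ}, HasDerivAt x y t →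
      HasDerivAt (fun t => (x t).2) y.2 t := fun hd => by
    have := (hasFDerivAt_snd (𝕜 := ℝ) (p := x _)).comp_hasDerivAt _ hd
    exact this
  exact
    { duration_nonneg := h.nonneg
      measurable_forward := h.measurable_forward
      measurable_angular := h.measurable_angular
      controls_mem := fun t ht => hU _ _ (h.forward_le t ht) (h.angular_le t ht)
      absCont_rho :=
        (LipschitzWith.prod_fst.comp_lipschitzOnWith hK).absolutelyContinuousOnInterval
      absCont_psi :=
        (LipschitzWith.prod_fst.comp_lipschitzOnWith hK2).absolutelyContinuousOnInterval
      absCont_beta :=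
        (LipschitzWith.prod_snd.comp_lipschitzOnWith hK2).absolutelyContinuousOnInterval
      rho_pos := h.pos
      deriv_rho := by
        filter_upwards [hae] with t ht hm
        exact (hasFDerivAt_fst (𝕜 := ℝ) (p := x _)).comp_hasDerivAt _ (ht hm)
      deriv_psi := by
        filter_upwards [hae] with t ht hm
        exact (hasFDerivAt_fst (𝕜 := ℝ) (p := (x _).2)).comp_hasDerivAt _ (hsnd (ht hm))
      deriv_beta := by
        filter_upwards [hae] with t ht hm
        exact (hasFDerivAt_snd (𝕜 := ℝ) (p := (x _).2)).comp_hasDerivAt _ (hsnd (ht hm))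
      sensor_right := fun t ht => sub_nonneg.2 (h.cone t ht).1
      sensor_left := fun t ht => sub_nonpos.2 (h.cone t ht).2 }

theorem restrict (h : IsDriven ε φ₁ φ₂ T x ν ω) {a b : ℝ} (ha : 0 ≤ a) (hab : a ≤ b)
    (hb : b ≤ T) :
    IsDriven ε φ₁ φ₂ (b - a) (fun t => x (a + t)) (fun t => ν (a + t)) (fun t => ω (a + t)) := by
  obtain ⟨K, hK⟩ := h.lipschitz
  obtain ⟨N, hN, hd⟩ := h.deriv
  have hmem : ∀ t ∈ Icc 0 (b - a), a + t ∈ Icc 0 T := fun t ht =>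
    ⟨by linarith [ht.1], by linarith [ht.2]⟩
  refine ⟨sub_nonneg.2 hab, h.measurable_forward.comp (measurable_const_add a),
    h.measurable_angular.comp (measurable_const_add a), fun t ht => h.forward_le _ (hmem t ht),
    fun t ht => h.angular_le _ (hmem t ht), ⟨K, fun s hs t ht => ?_⟩,
    fun t ht => h.pos _ (hmem t ht), fun t ht => h.cone _ (hmem t ht),
    (fun t => a + t) ⁻¹' N, hN.preimage (add_right_injective a), fun t ht htN => ?_⟩
  · simpa [edist_add_left] using hK (hmem s hs) (hmem t ht)
  · exact (hd (a + t) ⟨by linarith [ht.1], by linarith [ht.2]⟩ htN).comp_const_add a t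

theorem reverse (h : IsDriven ε φ₁ φ₂ T x ν ω) :
    IsDriven ε φ₁ φ₂ T (fun t => x (T - t)) (fun t => -ν (T - t)) (fun t => -ω (T - t)) := by
  obtain ⟨K, hK⟩ := h.lipschitz
  obtain ⟨N, hN, hd⟩ := h.deriv
  have hmem : ∀ t ∈ Icc 0 T, T - t ∈ Icc 0 T := fun t ht =>
    ⟨by linarith [ht.2], by linarith [ht.1]⟩
  refine ⟨h.nonneg, (h.measurable_forward.comp (measurable_const.sub measurable_id)).neg,
    (h.measurable_angular.comp (measurable_const.sub measurable_id)).neg,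
    fun t ht => by rw [abs_neg]; exact h.forward_le _ (hmem t ht),
    fun t ht => by rw [abs_neg]; exact h.angular_le _ (hmem t ht), ⟨K, fun s hs t ht => ?_⟩,
    fun t ht => h.pos _ (hmem t ht), fun t ht => h.cone _ (hmem t ht),
    (fun t => T - t) ⁻¹' N, hN.preimage (sub_right_injective), fun t ht htN => ?_⟩
  · simpa [edist_sub_left] using hK (hmem s hs) (hmem t ht)
  · refine ((hd (T - t) ⟨by linarith [ht.2], by linarith [ht.1]⟩ htN).comp_const_sub T t
      ).congr_deriv ?_
    simp only [unicycleField, Prod.neg_mk]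
    refine Prod.ext (by simp) (Prod.ext (by simp) (by simp; ring))

theorem mirror (h : IsDriven ε φ₁ φ₂ T x ν ω) :
    IsDriven ε (-φ₂) (-φ₁) T (fun t => ((x t).1, -(x t).2.1, -(x t).2.2)) ν (fun t => -ω t) := by
  obtain ⟨K, hK⟩ := h.lipschitz
  obtain ⟨N, hN, hd⟩ := h.deriv
  refine ⟨h.nonneg, h.measurable_forward, h.measurable_angular.neg, h.forward_le,
    fun t ht => by rw [abs_neg]; exact h.angular_le t ht, ⟨K, fun s hs t ht => ?_⟩,
    h.pos, fun t ht => ⟨neg_le_neg (h.cone t ht).2, neg_le_neg (h.cone t ht).1⟩,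
    N, hN, fun t ht htN => ?_⟩
  · simpa [Prod.edist_eq, edist_neg_neg] using hK hs ht
  · have hx := hd t ht htN
    have h1 := (hasFDerivAt_fst (𝕜 := ℝ) (p := x t)).comp_hasDerivAt _ hx
    have h2 := (hasFDerivAt_snd (𝕜 := ℝ) (p := x t)).comp_hasDerivAt _ hx
    refine (h1.prodMk h2.neg).congr_deriv ?_
    simp only [unicycleField, Real.cos_neg, Real.sin_neg]
    refine Prod.ext (by simp) (Prod.ext (by simp; ring) (by simp; ring))

/-- A vehicle turned round by `π` and driven in reverse covers the same path. -/
theorem halfTurn (h : IsDriven ε φ₁ φ₂ T x ν ω) :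
    IsDriven ε (φ₁ + Real.pi) (φ₂ + Real.pi) T
      (fun t => ((x t).1, (x t).2.1, (x t).2.2 + Real.pi)) (fun t => -ν t) ω := by
  obtain ⟨K, hK⟩ := h.lipschitz
  obtain ⟨N, hN, hd⟩ := h.deriv
  refine ⟨h.nonneg, h.measurable_forward.neg, h.measurable_angular,
    fun t ht => by rw [abs_neg]; exact h.forward_le t ht, h.angular_le, ⟨K, fun s hs t ht => ?_⟩,
    h.pos, fun t ht => ⟨by linarith [(h.cone t ht).1], by linarith [(h.cone t ht).2]⟩,
    N, hN, fun t ht htN => ?_⟩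
  · simpa [Prod.edist_eq, edist_add_right] using hK hs ht
  · have hx := hd t ht htN
    have h1 := (hasFDerivAt_fst (𝕜 := ℝ) (p := x t)).comp_hasDerivAt _ hx
    have h2 := (hasFDerivAt_snd (𝕜 := ℝ) (p := x t)).comp_hasDerivAt _ hx
    have h3 := (hasFDerivAt_fst (𝕜 := ℝ) (p := (x t).2)).comp_hasDerivAt _ h2
    have h4 := (hasFDerivAt_snd (𝕜 := ℝ) (p := (x t).2)).comp_hasDerivAt _ h2
    refine (h1.prodMk (h3.prodMk (h4.add_const Real.pi))).congr_deriv ?_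
    simp only [unicycleField, Real.cos_add_pi, Real.sin_add_pi]
    refine Prod.ext (by simp) (Prod.ext (by simp; ring) (by simp; ring))

theorem append (h : IsDriven ε φ₁ φ₂ T x ν ω) {T' : ℝ} {x' : ℝ → ℝ × ℝ × ℝ} {ν' ω' : ℝ → ℝ}
    (h' : IsDriven ε φ₁ φ₂ T' x' ν' ω') (hx : x T = x' 0) :
    IsDriven ε φ₁ φ₂ (T + T') (fun t => if t ≤ T then x t else x' (t - T))
      (fun t => if t ≤ T then ν t else ν' (t - T)) (fun t => if t ≤ T then ω t else ω' (t - T)) := by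
  obtain ⟨K, hK⟩ := h.lipschitz
  obtain ⟨N, hN, hd⟩ := h.deriv
  obtain ⟨K', hK'⟩ := h'.lipschitz
  obtain ⟨N', hN', hd'⟩ := h'.deriv
  have hT := h.nonneg
  have hT' := h'.nonneg
  have hl : ∀ t ∈ Icc 0 (T + T'), t ≤ T → t ∈ Icc 0 T := fun t ht h => ⟨ht.1, h⟩
  have hr : ∀ t ∈ Icc 0 (T + T'), ¬ t ≤ T → t - T ∈ Icc 0 T' := fun t ht h =>
    ⟨by linarith [not_le.1 h], by linarith [ht.2]⟩
  refine ⟨add_nonneg hT hT',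
    Measurable.ite measurableSet_Iic h.measurable_forward
      (h'.measurable_forward.comp (measurable_id.sub_const T)),
    Measurable.ite measurableSet_Iic h.measurable_angular
      (h'.measurable_angular.comp (measurable_id.sub_const T)),
    fun t ht => ?_, fun t ht => ?_, ⟨max K K', ?_⟩, fun t ht => ?_, fun t ht => ?_,
    -- The junction time is exceptional, since the velocity may jump there; this is why a countable
    -- exceptional set is allowed.
    insert T (N ∪ (fun t => t - T) ⁻¹' N'),
    (hN.union (hN'.preimage (sub_left_injective))).insert _, fun t ht htN => ?_⟩
  · split_ifs with hc
    exacts [h.forward_le _ (hl t ht hc), h'.forward_le _ (hr t ht hc)]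
  · split_ifs with hc
    exacts [h.angular_le _ (hl t ht hc), h'.angular_le _ (hr t ht hc)]
  · have key : ∀ s ∈ Icc 0 (T + T'), ∀ t ∈ Icc 0 (T + T'), s ≤ t →
        dist (if s ≤ T then x s else x' (s - T)) (if t ≤ T then x t else x' (t - T)) ≤
          (max K K' : NNReal) * dist s t := by
      intro s hs t ht hst
      have e1 : (K : ℝ) ≤ (max K K' : NNReal) := NNReal.coe_le_coe.2 (le_max_left _ _)
      have e2 : (K' : ℝ) ≤ (max K K' : NNReal) := NNReal.coe_le_coe.2 (le_max_right _ _)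
      by_cases c1 : s ≤ T <;> by_cases c2 : t ≤ T <;> simp only [c1, c2, if_true, if_false]
      · exact (hK.dist_le_mul _ (hl s hs c1) _ (hl t ht c2)).trans
          (mul_le_mul_of_nonneg_right e1 dist_nonneg)
      · have d1 := hK.dist_le_mul _ (hl s hs c1) T ⟨hT, le_rfl⟩
        have d2 := hK'.dist_le_mul 0 ⟨le_rfl, hT'⟩ _ (hr t ht c2)
        have d3 := dist_triangle (x s) (x T) (x' (t - T))
        rw [hx] at d3 d1
        rw [Real.dist_eq, abs_of_nonpos (by linarith)] at d1 d2
        rw [Real.dist_eq, abs_of_nonpos (by linarith)]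
        have := not_le.1 c2
        nlinarith
      · exact absurd (hst.trans c2) c1
      · refine (hK'.dist_le_mul _ (hr s hs c1) _ (hr t ht c2)).trans ?_
        rw [Real.dist_eq, sub_sub_sub_cancel_right, ← Real.dist_eq]
        exact mul_le_mul_of_nonneg_right e2 dist_nonneg
    refine LipschitzOnWith.of_dist_le_mul fun s hs t ht => ?_
    rcases le_total s t with hst | hst
    · exact key s hs t ht hst
    · rw [dist_comm, dist_comm s t]; exact key t ht s hs hst
  · split_ifs with hc
    exacts [h.pos _ (hl t ht hc), h'.pos _ (hr t ht hc)]
  · split_ifs with hc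
    exacts [h.cone _ (hl t ht hc), h'.cone _ (hr t ht hc)]
  · simp only [mem_insert_iff, mem_union, mem_preimage, not_or] at htN
    obtain ⟨htT, htN1, htN2⟩ := htN
    rcases lt_or_gt_of_ne htT with hlt | hgt
    · rw [if_pos hlt.le, if_pos hlt.le, if_pos hlt.le]
      refine (hd t ⟨ht.1, hlt⟩ htN1).congr_of_eventuallyEq ?_
      filter_upwards [Iio_mem_nhds hlt] with s hs
      rw [if_pos (le_of_lt hs)]
    · rw [if_neg hgt.not_ge, if_neg hgt.not_ge, if_neg hgt.not_ge]
      refine ((hd' (t - T) ⟨by linarith, by linarith [ht.2]⟩ htN2).comp_sub_const t T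
        ).congr_of_eventuallyEq ?_
      filter_upwards [Ioi_mem_nhds hgt] with s hs
      rw [if_neg (not_le.2 hs)]

end IsDriven

/-- A continuously differentiable solution of the kinematic equations becomes admissible when it is
run slowly enough. -/
theorem exists_isDriven {ε φ₁ φ₂ a b : ℝ} (hε : 0 < ε) (hab : a ≤ b) {x : ℝ → ℝ × ℝ × ℝ}
    {ν ω : ℝ → ℝ} (hν : Measurable ν) (hω : Measurable ω) (hνc : ContinuousOn ν (Icc a b))
    (hωc : ContinuousOn ω (Icc a b)) (hpos : ∀ t ∈ Icc a b, 0 < (x t).1)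
    (hcone : ∀ t ∈ Icc a b, (x t).2.2 ∈ Icc φ₁ φ₂)
    (hd : ∀ t ∈ Icc a b, HasDerivAt x (unicycleField (x t) (ν t) (ω t)) t) :
    ∃ c, 0 < c ∧ IsDriven ε φ₁ φ₂ ((b - a) / c) (fun t => x (a + c * t))
      (fun t => c * ν (a + c * t)) (fun t => c * ω (a + c * t)) := by
  obtain ⟨M, hM⟩ := isCompact_Icc.exists_bound_of_continuousOn hνc
  obtain ⟨M', hM'⟩ := isCompact_Icc.exists_bound_of_continuousOn hωc
  have hM0 : 0 ≤ M := (norm_nonneg _).trans (hM a (left_mem_Icc.2 hab))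
  have hM0' : 0 ≤ M' := (norm_nonneg _).trans (hM' a (left_mem_Icc.2 hab))
  have hxc : ContinuousOn x (Icc a b) := fun t ht => (hd t ht).continuousAt.continuousWithinAt
  have hfc : ContinuousOn (fun t => unicycleField (x t) (ν t) (ω t)) (Icc a b) := by
    have h1 : ContinuousOn (fun t => (x t).1) (Icc a b) := hxc.fst
    have h2 : ContinuousOn (fun t => (x t).2.2) (Icc a b) := hxc.snd.snd
    have hs : ContinuousOn (fun t => Real.sin (x t).2.2 / (x t).1 * ν t) (Icc a b) :=
      ((Real.continuous_sin.comp_continuousOn h2).div h1 fun t ht => (hpos t ht).ne').mul hνc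
    exact ((Real.continuous_cos.comp_continuousOn h2).neg.mul hνc).prodMk
      (hs.prodMk (hs.sub hωc))
  obtain ⟨L, hL⟩ := isCompact_Icc.exists_bound_of_continuousOn hfc
  have hxL : LipschitzOnWith (Real.toNNReal L) x (Icc a b) :=
    (convex_Icc a b).lipschitzOnWith_of_nnnorm_hasDerivWithin_le
      (fun t ht => (hd t ht).hasDerivWithinAt) fun t ht => by
        rw [← NNReal.coe_le_coe, coe_nnnorm]
        exact (hL t ht).trans (Real.le_coe_toNNReal L)
  -- The time scaling brings both controls below `ε`; the `1` keeps the denominator positive.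
  set c := ε / (M + M' + 1) with hc
  have hcpos : 0 < c := by positivity
  have hcM : c * (M + M' + 1) = ε := by rw [hc]; field_simp
  have hmem : ∀ t ∈ Icc 0 ((b - a) / c), a + c * t ∈ Icc a b := fun t ht => by
    have h1 := mul_nonneg hcpos.le ht.1
    have h2 := (le_div_iff₀ hcpos).1 ht.2
    exact ⟨by linarith, by linarith⟩
  have haff : Measurable fun t : ℝ => a + c * t := by fun_prop
  refine ⟨c, hcpos, div_nonneg (sub_nonneg.2 hab) hcpos.le, (hν.comp haff).const_mul c,
    (hω.comp haff).const_mul c, fun t ht => ?_, fun t ht => ?_,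
    ⟨Real.toNNReal L * Real.toNNReal c, ?_⟩, fun t ht => hpos _ (hmem t ht),
    fun t ht => hcone _ (hmem t ht), ∅, countable_empty, fun t ht _ => ?_⟩
  · rw [abs_mul, abs_of_pos hcpos]
    have := hM _ (hmem t ht)
    rw [Real.norm_eq_abs] at this
    nlinarith
  · rw [abs_mul, abs_of_pos hcpos]
    have := hM' _ (hmem t ht)
    rw [Real.norm_eq_abs] at this
    nlinarith
  · refine hxL.comp (LipschitzOnWith.of_dist_le_mul fun s _ t _ => ?_) fun t ht => hmem t ht
    rw [Real.dist_eq, Real.dist_eq, Real.coe_toNNReal c hcpos.le, add_sub_add_left_eq_sub,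
      ← mul_sub, abs_mul, abs_of_pos hcpos]
  · have h1 : HasDerivAt (fun t : ℝ => a + c * t) c t := by
      simpa using ((hasDerivAt_id t).const_mul c).const_add a
    refine ((hd _ (hmem t (Ioo_subset_Icc_self ht))).scomp t h1).congr_deriv ?_
    simp only [unicycleField, Prod.smul_mk, smul_eq_mul]
    refine Prod.ext (by simp; ring) (Prod.ext (by simp; ring) (by simp; ring))

theorem hasDerivAt_statePoint {x : ℝ → ℝ × ℝ × ℝ} {ν ω t : ℝ} (hpos : 0 < (x t).1)
    (hd : HasDerivAt x (unicycleField (x t) ν ω) t) :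
    ∃ z', HasDerivAt (fun t => statePoint (x t)) z' t ∧ ‖z'‖ = |ν| := by
  have h1 := (hasFDerivAt_fst (𝕜 := ℝ) (p := x t)).comp_hasDerivAt _ hd
  have h2 := (hasFDerivAt_snd (𝕜 := ℝ) (p := x t)).comp_hasDerivAt _ hd
  have h3 := (hasFDerivAt_fst (𝕜 := ℝ) (p := (x t).2)).comp_hasDerivAt _ h2
  exact ⟨_, hasDerivAt_polarPoint h1 h3, norm_velocity hpos⟩

theorem eVariationOn_le_of_dist_le {z : ℝ → ℂ} {l : ℝ → ℝ} {a b : ℝ} (hab : a ≤ b)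
    (h : ∀ s ∈ Icc a b, ∀ t ∈ Icc a b, s ≤ t → dist (z s) (z t) ≤ l t - l s) :
    eVariationOn z (Icc a b) ≤ ENNReal.ofReal (l b - l a) := by
  have hmono : MonotoneOn l (Icc a b) := fun s hs t ht hst => by
    linarith [h s hs t ht hst, dist_nonneg (x := z s) (y := z t)]
  have hl : eVariationOn l (Icc a b) ≤ ENNReal.ofReal (l b - l a) := by
    simpa using (hmono.eVariationOn_eq (left_mem_Icc.2 hab) (right_mem_Icc.2 hab)).le
  refine le_trans (iSup_mono fun p => Finset.sum_le_sum fun i _ => ?_) hl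
  obtain ⟨n, u, hu, us⟩ := p
  have := h _ (us i) _ (us (i + 1)) (hu (Nat.le_succ i))
  simp only
  rw [edist_dist, edist_dist]
  refine ENNReal.ofReal_le_ofReal ?_
  rw [dist_comm, Real.dist_eq]
  exact this.trans (le_abs_self _)

theorem dist_statePoint_le {x : ℝ → ℝ × ℝ × ℝ} {ν ω l : ℝ → ℝ} {a b : ℝ}
    (hpos : ∀ t ∈ Icc a b, 0 < (x t).1)
    (hd : ∀ t ∈ Icc a b, HasDerivAt x (unicycleField (x t) (ν t) (ω t)) t)
    (hl : ∀ t ∈ Icc a b, HasDerivAt l |ν t| t) :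
    ∀ s ∈ Icc a b, ∀ t ∈ Icc a b, s ≤ t →
      dist (statePoint (x s)) (statePoint (x t)) ≤ l t - l s := by
  intro s hs t ht hst
  have hsub : Icc s t ⊆ Icc a b := Icc_subset_Icc hs.1 ht.2
  choose! z' hz' hn using fun u (hu : u ∈ Icc a b) => hasDerivAt_statePoint (hpos u hu) (hd u hu)
  rw [dist_comm, dist_eq_norm]
  refine image_norm_le_of_norm_deriv_right_le_deriv_boundary'
    (f := fun u => statePoint (x u) - statePoint (x s)) (f' := z') (B := fun u => l u - l s)
    (B' := fun u => |ν u|) (a := s) (b := t) ?_ ?_ (by simp) ?_ ?_ ?_ (right_mem_Icc.2 hst)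
  · exact fun u hu => ((hz' u (hsub hu)).sub_const _).continuousAt.continuousWithinAt
  · exact fun u hu => ((hz' u (hsub (Ico_subset_Icc_self hu))).sub_const _).hasDerivWithinAt
  · exact fun u hu => ((hl u (hsub hu)).sub_const _).continuousAt.continuousWithinAt
  · exact fun u hu => ((hl u (hsub (Ico_subset_Icc_self hu))).sub_const _).hasDerivWithinAt
  · exact fun u hu => (hn u (hsub (Ico_subset_Icc_self hu))).le

/-! ### Reachability with a bound on length -/

/-- The state `Y` can be reached from the state `X` along a path of length at most `ℓ`. -/
def StateReach (ε φ₁ φ₂ : ℝ) (X Y : ℝ × ℝ × ℝ) (ℓ : ℝ) : Prop :=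
  0 ≤ ℓ ∧ ∃ (T : ℝ) (x : ℝ → ℝ × ℝ × ℝ) (ν ω : ℝ → ℝ), IsDriven ε φ₁ φ₂ T x ν ω ∧
    x 0 = X ∧ x T = Y ∧ eVariationOn (fun t => statePoint (x t)) (Icc 0 T) ≤ ENNReal.ofReal ℓ

theorem StateReach.mem_cone {ε φ₁ φ₂ ℓ : ℝ} {X Y : ℝ × ℝ × ℝ} (h : StateReach ε φ₁ φ₂ X Y ℓ) :
    0 < X.1 ∧ X.2.2 ∈ Icc φ₁ φ₂ ∧ 0 < Y.1 ∧ Y.2.2 ∈ Icc φ₁ φ₂ := by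
  obtain ⟨_, T, x, ν, ω, hx, h0, hT, -⟩ := h
  have i0 := left_mem_Icc.2 hx.nonneg
  have iT := right_mem_Icc.2 hx.nonneg
  exact ⟨h0 ▸ hx.pos 0 i0, h0 ▸ hx.cone 0 i0, hT ▸ hx.pos T iT, hT ▸ hx.cone T iT⟩

theorem StateReach.trans {ε φ₁ φ₂ ℓ ℓ' : ℝ} {X Y Z : ℝ × ℝ × ℝ}
    (h : StateReach ε φ₁ φ₂ X Y ℓ) (h' : StateReach ε φ₁ φ₂ Y Z ℓ') :
    StateReach ε φ₁ φ₂ X Z (ℓ + ℓ') := by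
  obtain ⟨hℓ, T, x, ν, ω, hx, h0, hT, hv⟩ := h
  obtain ⟨hℓ', T', x', ν', ω', hx', h0', hT', hv'⟩ := h'
  have hTn := hx.nonneg
  have hTn' := hx'.nonneg
  refine ⟨add_nonneg hℓ hℓ', _, _, _, _, hx.append hx' (hT.trans h0'.symm), ?_, ?_, ?_⟩
  · simp [hTn, h0]
  · by_cases hc : T' ≤ 0
    · have : T' = 0 := le_antisymm hc hTn'
      subst this
      simp [hT, ← hT', h0']
    · simp [hc, hT']
  · have hadd := eVariationOn.Icc_add_Icc
      (fun t => statePoint (if t ≤ T then x t else x' (t - T))) (s := univ) hTn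
      (le_add_of_nonneg_right hTn') (mem_univ _)
    simp only [univ_inter] at hadd
    rw [← hadd, ENNReal.ofReal_add hℓ hℓ']
    refine add_le_add (le_of_eq_of_le (eVariationOn.congr fun t ht => ?_) hv)
      (le_of_eq_of_le (eVariationOn.congr fun t ht => ?_)
        ((eVariationOn.comp_le_of_monotoneOn (fun t => statePoint (x' t)) (s := Icc 0 T')
          (t := Icc T (T + T'))
          (fun t => t - T) (fun s _ t _ hst => by simpa using hst)
          fun t ht => ⟨by linarith [ht.1], by linarith [ht.2]⟩).trans hv'))
    · simp only [if_pos ht.2]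
    · rcases eq_or_lt_of_le ht.1 with rfl | hlt
      · simp [hT, h0']
      · simp [not_le.2 hlt]

/-- The curve may have any convenient parameter, as slowing it down does not change its trace. The
function `l` is a primitive of the speed. -/
theorem StateReach.of_curve {ε φ₁ φ₂ a b : ℝ} (hε : 0 < ε) (hab : a ≤ b) {x : ℝ → ℝ × ℝ × ℝ}
    {ν ω l : ℝ → ℝ} (hν : Measurable ν) (hω : Measurable ω) (hνc : ContinuousOn ν (Icc a b))
    (hωc : ContinuousOn ω (Icc a b)) (hpos : ∀ t ∈ Icc a b, 0 < (x t).1)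
    (hcone : ∀ t ∈ Icc a b, (x t).2.2 ∈ Icc φ₁ φ₂)
    (hd : ∀ t ∈ Icc a b, HasDerivAt x (unicycleField (x t) (ν t) (ω t)) t)
    (hl : ∀ t ∈ Icc a b, HasDerivAt l |ν t| t) :
    StateReach ε φ₁ φ₂ (x a) (x b) (l b - l a) := by
  obtain ⟨c, hc, h⟩ := exists_isDriven hε hab hν hω hνc hωc hpos hcone hd
  have hdist := dist_statePoint_le hpos hd hl
  refine ⟨?_, _, _, _, _, h, by simp, ?_, ?_⟩
  · exact dist_nonneg.trans (hdist a (left_mem_Icc.2 hab) b (right_mem_Icc.2 hab) hab)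
  · congr 1; field_simp; ring
  · refine le_trans ?_ (eVariationOn_le_of_dist_le hab hdist)
    refine eVariationOn.comp_le_of_monotoneOn (fun t => statePoint (x t)) (fun t => a + c * t)
      (fun s _ t _ hst => by simpa using mul_le_mul_of_nonneg_left hst hc.le) fun t ht => ?_
    have h1 := mul_nonneg hc.le ht.1
    have h2 := (le_div_iff₀ hc).1 ht.2
    exact ⟨by linarith, by linarith⟩

/-- Rotation on the spot costs no length, so arcs can be joined without matching headings. The cone
is convex, so the intermediate bearings are permitted. -/
theorem StateReach.rotate {ε φ₁ φ₂ ρ ψ β β' : ℝ} (hε : 0 < ε) (hρ : 0 < ρ) (hβ : β ∈ Icc φ₁ φ₂)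
    (hβ' : β' ∈ Icc φ₁ φ₂) : StateReach ε φ₁ φ₂ (ρ, ψ, β) (ρ, ψ, β') 0 := by
  have := StateReach.of_curve (φ₁ := φ₁) (φ₂ := φ₂) hε zero_le_one
    (x := fun t => (ρ, ψ, β + t * (β' - β))) (ν := fun _ => 0) (ω := fun _ => -(β' - β))
    (l := fun _ => 0) measurable_const measurable_const continuousOn_const continuousOn_const
    (fun _ _ => hρ) (fun t ht => ?_) (fun t _ => ?_) (fun t _ => by simpa using hasDerivAt_const t 0)
  · simpa using this
  · have := (convex_Icc φ₁ φ₂).add_smul_sub_mem hβ hβ' ht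
    simpa using this
  · have h1 : HasDerivAt (fun t => β + t * (β' - β)) (β' - β) t := by
      simpa using ((hasDerivAt_id t).mul_const (β' - β)).const_add β
    refine ((hasDerivAt_const t ρ).prodMk ((hasDerivAt_const t ψ).prodMk h1)).congr_deriv ?_
    simp [unicycleField]

/-- The point `(ρ₁, ψ₁)` can be reached from `(ρ₀, ψ₀)` along a path of length at most `ℓ`, with
free initial and final headings. -/
def Reach (ε φ₁ φ₂ ρ₀ ψ₀ ρ₁ ψ₁ ℓ : ℝ) : Prop :=
  ∃ β₀ β₁, StateReach ε φ₁ φ₂ (ρ₀, ψ₀, β₀) (ρ₁, ψ₁, β₁) ℓ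

namespace Reach

variable {ε φ₁ φ₂ ρ₀ ψ₀ ρ₁ ψ₁ ρ₂ ψ₂ ℓ ℓ' : ℝ}

theorem refl (hε : 0 < ε) (hφ : φ₁ ≤ φ₂) (hρ : 0 < ρ₀) : Reach ε φ₁ φ₂ ρ₀ ψ₀ ρ₀ ψ₀ 0 :=
  ⟨φ₁, φ₁, StateReach.rotate hε hρ (left_mem_Icc.2 hφ) (left_mem_Icc.2 hφ)⟩

theorem trans (hε : 0 < ε) (h : Reach ε φ₁ φ₂ ρ₀ ψ₀ ρ₁ ψ₁ ℓ) (h' : Reach ε φ₁ φ₂ ρ₁ ψ₁ ρ₂ ψ₂ ℓ') :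
    Reach ε φ₁ φ₂ ρ₀ ψ₀ ρ₂ ψ₂ (ℓ + ℓ') := by
  obtain ⟨β₀, β₁, h⟩ := h
  obtain ⟨β₁', β₂, h'⟩ := h'
  have hr := StateReach.rotate (ψ := ψ₁) hε h.mem_cone.2.2.1 h.mem_cone.2.2.2 h'.mem_cone.2.1
  exact ⟨β₀, β₂, by simpa using (h.trans hr).trans h'⟩

theorem symm (h : Reach ε φ₁ φ₂ ρ₀ ψ₀ ρ₁ ψ₁ ℓ) : Reach ε φ₁ φ₂ ρ₁ ψ₁ ρ₀ ψ₀ ℓ := by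
  obtain ⟨β₀, β₁, hℓ, T, x, ν, ω, hx, h0, hT, hv⟩ := h
  refine ⟨β₁, β₀, hℓ, T, _, _, _, hx.reverse, by simp [hT], by simp [h0], le_trans ?_ hv⟩
  exact eVariationOn.comp_le_of_antitoneOn (fun t => statePoint (x t)) (fun t => T - t)
    (fun s _ t _ hst => sub_le_sub_left hst T)
    fun t ht => ⟨by linarith [ht.2], by linarith [ht.1]⟩

theorem mirror (h : Reach ε φ₁ φ₂ ρ₀ ψ₀ ρ₁ ψ₁ ℓ) :
    Reach ε (-φ₂) (-φ₁) ρ₀ (-ψ₀) ρ₁ (-ψ₁) ℓ := by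
  obtain ⟨β₀, β₁, hℓ, T, x, ν, ω, hx, h0, hT, hv⟩ := h
  refine ⟨-β₀, -β₁, hℓ, T, _, _, _, hx.mirror, by simp [h0], by simp [hT], le_of_eq_of_le ?_ hv⟩
  have : ∀ s t, edist (statePoint ((x s).1, -(x s).2.1, -(x s).2.2))
      (statePoint ((x t).1, -(x t).2.1, -(x t).2.2)) = edist (statePoint (x s)) (statePoint (x t)) := by
    have hconj : ∀ t, statePoint ((x t).1, -(x t).2.1, -(x t).2.2) =
        (starRingEnd ℂ) (statePoint (x t)) := fun t => by
      simp only [statePoint, polarPoint, map_mul, Complex.conj_ofReal, ← Complex.exp_conj,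
        Complex.conj_I]
      congr 2; push_cast; ring
    intro s t
    rw [hconj, hconj, edist_dist, edist_dist, Complex.dist_conj_conj]
  unfold eVariationOn
  simp only [this]

theorem halfTurn (h : Reach ε φ₁ φ₂ ρ₀ ψ₀ ρ₁ ψ₁ ℓ) :
    Reach ε (φ₁ + Real.pi) (φ₂ + Real.pi) ρ₀ ψ₀ ρ₁ ψ₁ ℓ := by
  obtain ⟨β₀, β₁, hℓ, T, x, ν, ω, hx, h0, hT, hv⟩ := h
  exact ⟨β₀ + Real.pi, β₁ + Real.pi, hℓ, T, _, _, _, hx.halfTurn, by simp [h0], by simp [hT], hv⟩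

end Reach

/-! ### Elementary arcs: spirals, circles, straight lines -/

namespace Reach

variable {ε φ₁ φ₂ : ℝ}

/-- At constant bearing, the parameter is minus the logarithm of the distance, up to a constant; the
distance then decreases exponentially and the polar angle grows linearly. -/
theorem spiral (hε : 0 < ε) {α ρ₀ ρ₁ : ℝ} (hα : α ∈ Icc φ₁ φ₂) (hcos : 0 < Real.cos α)
    (h1 : 0 < ρ₁) (h10 : ρ₁ ≤ ρ₀) (ψ : ℝ) :
    Reach ε φ₁ φ₂ ρ₀ ψ ρ₁ (ψ + Real.tan α * Real.log (ρ₀ / ρ₁)) ((ρ₀ - ρ₁) / Real.cos α) := by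
  have h0 : 0 < ρ₀ := h1.trans_le h10
  have hL : 0 ≤ Real.log (ρ₀ / ρ₁) := Real.log_nonneg ((one_le_div h1).2 h10)
  have hE : ρ₀ * Real.exp (-Real.log (ρ₀ / ρ₁)) = ρ₁ := by
    rw [Real.exp_neg, Real.exp_log (by positivity)]; field_simp
  have hd : ∀ t, HasDerivAt (fun t => ρ₀ * Real.exp (-t)) (-(ρ₀ * Real.exp (-t))) t := fun t => by
    have := ((Real.hasDerivAt_exp (-t)).comp t (hasDerivAt_neg t)).const_mul ρ₀
    exact this.congr_deriv (by ring)
  have := StateReach.of_curve (φ₁ := φ₁) (φ₂ := φ₂) hε hL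
    (x := fun t => (ρ₀ * Real.exp (-t), ψ + Real.tan α * t, α))
    (ν := fun t => ρ₀ * Real.exp (-t) / Real.cos α) (ω := fun _ => Real.tan α)
    (l := fun t => -(ρ₀ * Real.exp (-t)) / Real.cos α) (by fun_prop) measurable_const
    (by fun_prop) continuousOn_const (fun t _ => by positivity) (fun _ _ => hα)
    (fun t _ => ?_) (fun t _ => ?_)
  · refine ⟨α, α, ?_⟩
    simp only [hE] at this
    convert this using 1
    · simp
    · simp; ring
  · have h2 : HasDerivAt (fun t => ψ + Real.tan α * t) (Real.tan α) t := by
      simpa using ((hasDerivAt_id t).const_mul (Real.tan α)).const_add ψ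
    refine ((hd t).prodMk (h2.prodMk (hasDerivAt_const t α))).congr_deriv ?_
    have : 0 < Real.exp (-t) := Real.exp_pos _
    simp only [unicycleField, Real.tan_eq_sin_div_cos]
    refine Prod.ext (by field_simp) (Prod.ext (by field_simp) ?_)
    simp only
    field_simp
    ring
  · rw [abs_of_pos (by positivity)]
    exact ((hd t).neg.div_const _).congr_deriv (by ring)

theorem circle (hε : 0 < ε) {ρ θ : ℝ} (hα : Real.pi / 2 ∈ Icc φ₁ φ₂) (hρ : 0 < ρ) (hθ : 0 ≤ θ)
    (ψ : ℝ) : Reach ε φ₁ φ₂ ρ ψ ρ (ψ + θ) (ρ * θ) := by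
  have := StateReach.of_curve (φ₁ := φ₁) (φ₂ := φ₂) hε hθ
    (x := fun t => (ρ, ψ + t, Real.pi / 2)) (ν := fun _ => ρ) (ω := fun _ => 1)
    (l := fun t => ρ * t) measurable_const measurable_const
    continuousOn_const continuousOn_const (fun t _ => hρ) (fun _ _ => hα)
    (fun t _ => ?_) (fun t _ => ?_)
  · exact ⟨Real.pi / 2, Real.pi / 2, by simpa using this⟩
  · refine ((hasDerivAt_const t ρ).prodMk (((hasDerivAt_id t).const_add ψ).prodMk
      (hasDerivAt_const t (Real.pi / 2)))).congr_deriv ?_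
    simp [unicycleField, hρ.ne']
  · rw [abs_of_pos hρ]
    simpa using (hasDerivAt_id t).const_mul ρ

/-- On a line at distance `P` from the feature the bearing is itself the polar angle up to a
constant, so it serves as the parameter, with `ω = 0`. -/
theorem line (hε : 0 < ε) {P θ₁ θ₂ : ℝ} (hP : 0 < P) (h0 : 0 < θ₁) (h12 : θ₁ ≤ θ₂)
    (h2 : θ₂ < Real.pi) (hφ₁ : φ₁ ≤ θ₁) (hφ₂ : θ₂ ≤ φ₂) (ψ : ℝ) :
    Reach ε φ₁ φ₂ (P / Real.sin θ₁) ψ (P / Real.sin θ₂) (ψ + (θ₂ - θ₁))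
      (P * (Real.cos θ₁ / Real.sin θ₁ - Real.cos θ₂ / Real.sin θ₂)) := by
  have hsin : ∀ t ∈ Icc θ₁ θ₂, 0 < Real.sin t := fun t ht =>
    Real.sin_pos_of_pos_of_lt_pi (h0.trans_le ht.1) (ht.2.trans_lt h2)
  have := StateReach.of_curve (φ₁ := φ₁) (φ₂ := φ₂) hε h12
    (x := fun t => (P / Real.sin t, ψ + (t - θ₁), t))
    (ν := fun t => P / Real.sin t ^ 2) (ω := fun _ => 0)
    (l := fun t => -(P * (Real.cos t / Real.sin t))) (by fun_prop) measurable_const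
    (continuousOn_const.div (by fun_prop) fun t ht => by have := hsin t ht; positivity)
    continuousOn_const (fun t ht => by have := hsin t ht; positivity)
    (fun t ht => ⟨hφ₁.trans ht.1, ht.2.trans hφ₂⟩) (fun t ht => ?_) (fun t ht => ?_)
  · refine ⟨θ₁, θ₂, ?_⟩
    convert this using 1
    · simp
    · ring
  · have hs := hsin t ht
    have hd1 := (hasDerivAt_const t P).fun_div (Real.hasDerivAt_sin t) hs.ne'
    have hd2 : HasDerivAt (fun t => ψ + (t - θ₁)) 1 t :=
      ((hasDerivAt_id' t).sub_const θ₁).const_add ψ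
    refine (hd1.prodMk (hd2.prodMk (hasDerivAt_id' t))).congr_deriv ?_
    simp only [unicycleField]
    refine Prod.ext ?_ (Prod.ext ?_ ?_) <;> simp only <;> field_simp <;> ring
  · have hs := hsin t ht
    rw [abs_of_pos (by positivity)]
    have hd := (((Real.hasDerivAt_cos t).fun_div (Real.hasDerivAt_sin t) hs.ne').const_mul P).neg
    refine hd.congr_deriv ?_
    have := Real.sin_sq_add_cos_sq t
    field_simp
    linear_combination this

end Reach

/-! ### Potentials and the extremals they describe -/

/-- The function `f` up to `c` and the function `g` beyond. -/
noncomputable def glue (c : ℝ) (f g : ℝ → ℝ) (s : ℝ) : ℝ := if s ≤ c then f s else g s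

theorem hasDerivAt_glue {c s : ℝ} {f g f' g' : ℝ → ℝ} (hf : HasDerivAt f (f' s) s)
    (hg : HasDerivAt g (g' s) s) (h : s = c → f c = g c ∧ f' c = g' c) :
    HasDerivAt (glue c f g) (glue c f' g' s) s := by
  rcases lt_trichotomy s c with hlt | rfl | hgt
  · rw [glue, if_pos hlt.le]
    refine hf.congr_of_eventuallyEq ?_
    filter_upwards [Iio_mem_nhds hlt] with t ht
    rw [glue, if_pos (le_of_lt ht)]
  · obtain ⟨h1, h2⟩ := h rfl
    rw [glue, if_pos le_rfl]
    have hl : HasDerivWithinAt (glue s f g) (f' s) (Iic s) s :=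
      hf.hasDerivWithinAt.congr (fun t ht => if_pos ht) (if_pos le_rfl)
    have hr : HasDerivWithinAt (glue s f g) (f' s) (Ici s) s := by
      rw [h2]
      refine hg.hasDerivWithinAt.congr (fun t ht => ?_) (by rw [glue, if_pos le_rfl, h1])
      rcases eq_or_lt_of_le (show s ≤ t from ht) with rfl | hlt
      · rw [glue, if_pos le_rfl, h1]
      · rw [glue, if_neg hlt.not_ge]
    have := hl.union hr
    rwa [Iic_union_Ici, hasDerivWithinAt_univ] at this
  · rw [glue, if_neg hgt.not_ge]
    refine hg.congr_of_eventuallyEq ?_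
    filter_upwards [Ioi_mem_nhds hgt] with t ht
    rw [glue, if_neg (not_le.2 ht)]

/-- Inward motion along an extremal: with momentum `P`, the distance `P / s₁` is reached from
`P / s₀`, with displacement and length given by the potential `Φ` and its derivative `T`. -/
def IsLeg (ε φ₁ φ₂ : ℝ) (Φ T : ℝ → ℝ) (s₀ s₁ : ℝ) : Prop :=
  ∀ P, 0 < P → ∀ ψ, Reach ε φ₁ φ₂ (P / s₀) ψ (P / s₁) (ψ + (T s₁ - T s₀))
    (P * ((Φ s₀ / s₀ - T s₀) - (Φ s₁ / s₁ - T s₁)))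

namespace IsLeg

variable {ε φ₁ φ₂ s₀ s₁ s₂ : ℝ} {Φ T Φ' T' : ℝ → ℝ}

theorem trans (hε : 0 < ε) (h : IsLeg ε φ₁ φ₂ Φ T s₀ s₁) (h' : IsLeg ε φ₁ φ₂ Φ T s₁ s₂) :
    IsLeg ε φ₁ φ₂ Φ T s₀ s₂ := fun P hP ψ => by
  convert (h P hP ψ).trans hε (h' P hP _) using 1 <;> ring

theorem congr (h : IsLeg ε φ₁ φ₂ Φ T s₀ s₁) (h0 : Φ' s₀ = Φ s₀ ∧ T' s₀ = T s₀)
    (h1 : Φ' s₁ = Φ s₁ ∧ T' s₁ = T s₁) : IsLeg ε φ₁ φ₂ Φ' T' s₀ s₁ := fun P hP ψ => by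
  rw [h0.1, h0.2, h1.1, h1.2]
  exact h P hP ψ

theorem glue (hε : 0 < ε) {c : ℝ} (h01 : s₀ ≤ s₁)
    (hf : s₀ ≤ c → IsLeg ε φ₁ φ₂ Φ T s₀ (min s₁ c))
    (hg : c < s₁ → IsLeg ε φ₁ φ₂ Φ' T' (max s₀ c) s₁)
    (hm : s₀ ≤ c → c < s₁ → Φ c = Φ' c ∧ T c = T' c) :
    IsLeg ε φ₁ φ₂ (glue c Φ Φ') (_root_.glue c T T') s₀ s₁ := by
  have hl : ∀ {f g : ℝ → ℝ} {s}, s ≤ c → _root_.glue c f g s = f s := fun h => if_pos h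
  have hr : ∀ {f g : ℝ → ℝ} {s}, c < s → _root_.glue c f g s = g s := fun h => if_neg h.not_ge
  rcases le_or_gt s₁ c with h1 | h1
  · have := hf (h01.trans h1)
    rw [min_eq_left h1] at this
    exact this.congr ⟨hl (h01.trans h1), hl (h01.trans h1)⟩ ⟨hl h1, hl h1⟩
  · rcases le_or_gt s₀ c with h0 | h0
    · have i1 := hf h0
      have i2 := hg h1
      rw [min_eq_right h1.le] at i1
      rw [max_eq_right h0] at i2
      obtain ⟨e1, e2⟩ := hm h0 h1
      exact IsLeg.trans hε (i1.congr ⟨hl h0, hl h0⟩ ⟨hl le_rfl, hl le_rfl⟩)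
        (i2.congr ⟨(hl le_rfl).trans e1, (hl le_rfl).trans e2⟩ ⟨hr h1, hr h1⟩)
    · have := hg h1
      rw [max_eq_left h0.le] at this
      exact this.congr ⟨hr h0, hr h0⟩ ⟨hr h1, hr h1⟩

end IsLeg

/-- The potential of a logarithmic spiral with bearing `α`. -/
noncomputable def spiralPot (α k s : ℝ) : ℝ :=
  1 / Real.cos α + s * (Real.tan α * (Real.log s - 1) + k)

/-- The derivative of the potential of a logarithmic spiral. -/
noncomputable def spiralAngle (α k s : ℝ) : ℝ := Real.tan α * Real.log s + k

/-- The potential of a straight line. -/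
noncomputable def linePot (s : ℝ) : ℝ := √(1 - s ^ 2) + s * Real.arcsin s

/-- The constant for which a spiral continues a straight line smoothly. -/
noncomputable def spiralConst (α : ℝ) : ℝ := α - Real.tan α * Real.log (Real.sin α)

theorem hasDerivAt_spiralPot (α k : ℝ) {s : ℝ} (hs : 0 < s) :
    HasDerivAt (spiralPot α k) (spiralAngle α k s) s := by
  unfold spiralPot spiralAngle
  have h1 := ((((Real.hasDerivAt_log hs.ne').sub_const 1).const_mul (Real.tan α)).add_const k)
  refine (((hasDerivAt_id' s).mul h1).const_add (1 / Real.cos α)).congr_deriv ?_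
  field_simp
  ring

theorem hasDerivAt_linePot_of_ne {s : ℝ} (hs : 0 < s) (h1 : s ≠ 1) :
    HasDerivAt linePot (Real.arcsin s) s := by
  rcases lt_or_gt_of_ne h1 with hlt | hgt
  · have hpos : 0 < 1 - s ^ 2 := by nlinarith
    have hd1 : HasDerivAt (fun s : ℝ => 1 - s ^ 2) (-(2 * s)) s := by
      simpa using (hasDerivAt_pow 2 s).const_sub 1
    have hd := (hd1.sqrt hpos.ne').add ((hasDerivAt_id' s).mul
      (Real.hasDerivAt_arcsin (by linarith) hlt.ne))
    refine hd.congr_deriv ?_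
    have : 0 < √(1 - s ^ 2) := Real.sqrt_pos.2 hpos
    field_simp
    ring
  · rw [Real.arcsin_of_one_le hgt.le]
    have hd : HasDerivAt (fun s : ℝ => s * (Real.pi / 2)) (Real.pi / 2) s := by
      simpa using (hasDerivAt_id s).mul_const (Real.pi / 2)
    refine hd.congr_of_eventuallyEq ?_
    filter_upwards [Ioi_mem_nhds hgt] with t ht
    have ht : 1 < t := ht
    rw [linePot, Real.arcsin_of_one_le ht.le, Real.sqrt_eq_zero_of_nonpos (by nlinarith), zero_add]

theorem continuous_linePot : Continuous linePot := by
  unfold linePot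
  fun_prop

/-- At `s = 1` neither the square root nor `arcsin` is differentiable. The derivative comes from the
continuity of the potential and the one-sided limits of its derivative. -/
theorem hasDerivAt_linePot {s : ℝ} (hs : 0 < s) : HasDerivAt linePot (Real.arcsin s) s := by
  rcases eq_or_ne s 1 with rfl | h1
  · have hm : ∀ᶠ y in nhds (1 : ℝ), 0 < y := Ioi_mem_nhds one_pos
    have hl : HasDerivWithinAt linePot (Real.arcsin 1) (Iic 1) 1 := by
      refine hasDerivWithinAt_Iic_of_tendsto_deriv (s := Ioo 0 1) (fun y hy =>
        (hasDerivAt_linePot_of_ne hy.1 hy.2.ne).differentiableAt.differentiableWithinAt)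
        continuous_linePot.continuousWithinAt (Ioo_mem_nhdsLT one_pos) ?_
      refine (Real.continuous_arcsin.continuousAt.tendsto.mono_left nhdsWithin_le_nhds).congr' ?_
      filter_upwards [Ioo_mem_nhdsLT (one_pos (α := ℝ))] with y hy
      exact (hasDerivAt_linePot_of_ne hy.1 hy.2.ne).deriv.symm
    have hr : HasDerivWithinAt linePot (Real.arcsin 1) (Ici 1) 1 := by
      refine hasDerivWithinAt_Ici_of_tendsto_deriv (s := Ioi 1) (fun y hy =>
        (hasDerivAt_linePot_of_ne (one_pos.trans hy) (ne_of_gt hy)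
          ).differentiableAt.differentiableWithinAt)
        continuous_linePot.continuousWithinAt self_mem_nhdsWithin ?_
      refine (Real.continuous_arcsin.continuousAt.tendsto.mono_left nhdsWithin_le_nhds).congr' ?_
      filter_upwards [self_mem_nhdsWithin] with y hy
      exact (hasDerivAt_linePot_of_ne (one_pos.trans hy) (ne_of_gt hy)).deriv.symm
    have := hl.union hr
    rwa [Iic_union_Ici, hasDerivWithinAt_univ] at this
  · exact hasDerivAt_linePot_of_ne hs h1

/-- Line and spiral share the bearing `α` at `s = sin α`; `spiralConst` makes value and slope agree.
For `α = π / 2` the conventions `1 / 0 = 0` and `tan (π / 2) = 0` turn the spiral potential into `s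
* (π / 2)`, the correct continuation. -/
theorem spiral_eq_line {α : ℝ} (h0 : 0 < α) (h1 : α ≤ Real.pi / 2) :
    spiralPot α (spiralConst α) (Real.sin α) = linePot (Real.sin α) ∧
      spiralAngle α (spiralConst α) (Real.sin α) = Real.arcsin (Real.sin α) := by
  have hcos : 0 ≤ Real.cos α := Real.cos_nonneg_of_mem_Icc ⟨by linarith, h1⟩
  have hasin : Real.arcsin (Real.sin α) = α := Real.arcsin_sin (by linarith) h1
  have hsq : √(1 - Real.sin α ^ 2) = Real.cos α := by
    rw [← Real.cos_sq', Real.sqrt_sq hcos]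
  constructor
  · rw [spiralPot, spiralConst, linePot, hsq, hasin, Real.tan_eq_sin_div_cos]
    rcases eq_or_ne (Real.cos α) 0 with h | h
    · simp [h]
    · have := Real.sin_sq_add_cos_sq α
      field_simp
      linear_combination -this
  · rw [spiralAngle, spiralConst, hasin]; ring

theorem isLeg_spiral {ε φ₁ φ₂ α s₀ s₁ : ℝ} (hε : 0 < ε) (hα : α ∈ Icc φ₁ φ₂)
    (hcos : 0 < Real.cos α) (k : ℝ) (h0 : 0 < s₀) (h01 : s₀ ≤ s₁) :
    IsLeg ε φ₁ φ₂ (spiralPot α k) (spiralAngle α k) s₀ s₁ := fun P hP ψ => by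
  have h1 : 0 < s₁ := h0.trans_le h01
  have := Reach.spiral hε hα hcos (ρ₀ := P / s₀) (ρ₁ := P / s₁) (by positivity)
    (div_le_div_of_nonneg_left hP.le h0 h01) ψ
  convert this using 1
  · rw [show P / s₀ / (P / s₁) = s₁ / s₀ by field_simp, Real.log_div h1.ne' h0.ne']
    unfold spiralAngle; ring
  · unfold spiralPot spiralAngle
    field_simp
    ring

theorem isLeg_line {ε φ₁ φ₂ θ₁ θ₂ : ℝ} (hε : 0 < ε) (h0 : 0 < θ₁) (h12 : θ₁ ≤ θ₂)
    (h2 : θ₂ ≤ Real.pi / 2) (hφ₁ : φ₁ ≤ θ₁) (hφ₂ : θ₂ ≤ φ₂) :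
    IsLeg ε φ₁ φ₂ linePot Real.arcsin (Real.sin θ₁) (Real.sin θ₂) := fun P hP ψ => by
  have := Reach.line hε hP h0 h12 (by linarith [Real.pi_pos]) hφ₁ hφ₂ ψ
  have e : ∀ t, 0 < t → t ≤ Real.pi / 2 →
      linePot (Real.sin t) / Real.sin t - Real.arcsin (Real.sin t) = Real.cos t / Real.sin t ∧
      Real.arcsin (Real.sin t) = t := fun t ht ht2 => by
    have hs : 0 < Real.sin t := Real.sin_pos_of_pos_of_lt_pi ht (by linarith [Real.pi_pos])
    have ha : Real.arcsin (Real.sin t) = t := Real.arcsin_sin (by linarith) ht2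
    refine ⟨?_, ha⟩
    rw [linePot, ← Real.cos_sq', Real.sqrt_sq (Real.cos_nonneg_of_mem_Icc ⟨by linarith, ht2⟩)]
    field_simp
    ring
  obtain ⟨e1, e1'⟩ := e θ₁ h0 (h12.trans h2)
  obtain ⟨e2, e2'⟩ := e θ₂ (h0.trans_le h12) h2
  rw [e1, e2, e1', e2']
  exact this

/-- The potential of the extremals with bearing `arcsin s` truncated to `[A, B]`: a spiral, a
straight line and another spiral. -/
noncomputable def legPot (A B : ℝ) : ℝ → ℝ :=
  glue (Real.sin A) (spiralPot A (spiralConst A))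
    (glue (Real.sin B) linePot (spiralPot B (spiralConst B)))

/-- The polar angle along the extremals of `legPot`. -/
noncomputable def legAngle (A B : ℝ) : ℝ → ℝ :=
  glue (Real.sin A) (spiralAngle A (spiralConst A))
    (glue (Real.sin B) Real.arcsin (spiralAngle B (spiralConst B)))

theorem pos_of_sin_pos {x : ℝ} (hx : -Real.pi ≤ x) (h : 0 < Real.sin x) : 0 < x := by
  by_contra hx0
  exact absurd (Real.sin_nonpos_of_nonpos_of_neg_pi_le (not_lt.1 hx0) hx) (not_le.2 h)

section leg

variable {A B : ℝ}

theorem hasDerivAt_legPot (hA : -(Real.pi / 2) ≤ A) (hAB : A < B) (hB : B ≤ Real.pi / 2) {s : ℝ}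
    (hs : 0 < s) : HasDerivAt (legPot A B) (legAngle A B s) s := by
  have hpi := Real.pi_pos
  refine hasDerivAt_glue (hasDerivAt_spiralPot _ _ hs) (hasDerivAt_glue (hasDerivAt_linePot hs)
    (hasDerivAt_spiralPot _ _ hs) fun h => ?_) fun h => ?_
  · have hB0 : 0 < B := pos_of_sin_pos (by linarith) (h ▸ hs)
    obtain ⟨h1, h2⟩ := spiral_eq_line hB0 hB
    exact ⟨h1.symm, h2.symm⟩
  · have hA0 : 0 < A := pos_of_sin_pos (by linarith) (h ▸ hs)
    have hle : Real.sin A ≤ Real.sin B := (Real.sin_lt_sin_of_lt_of_le_pi_div_two hA hB hAB).le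
    rw [glue, glue, if_pos hle, if_pos hle]
    exact spiral_eq_line hA0 (hAB.le.trans hB)

/-- The last hypothesis excludes the inner spiral for `B = π / 2`, where motion at bearing `B` is
circular and makes no inward progress. -/
theorem isLeg_leg {ε φ₁ φ₂ s₀ s₁ : ℝ} (hε : 0 < ε) (hA : -(Real.pi / 2) ≤ A) (hAB : A < B)
    (hB : B ≤ Real.pi / 2) (hφ₁ : φ₁ ≤ A) (hφ₂ : B ≤ φ₂) (h0 : 0 < s₀) (h01 : s₀ ≤ s₁)
    (h1 : s₁ ≤ Real.sin B ∨ B < Real.pi / 2) :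
    IsLeg ε φ₁ φ₂ (legPot A B) (legAngle A B) s₀ s₁ := by
  have hpi := Real.pi_pos
  have hle : Real.sin A ≤ Real.sin B := (Real.sin_lt_sin_of_lt_of_le_pi_div_two hA hB hAB).le
  have hasinA : Real.arcsin (Real.sin A) = A := Real.arcsin_sin hA (hAB.le.trans hB)
  have hasinB : Real.arcsin (Real.sin B) = B := Real.arcsin_sin (by linarith) hB
  refine IsLeg.glue hε h01 (fun h => ?_) (fun h => ?_) fun h h' => ?_
  · have hA0 : 0 < A := pos_of_sin_pos (by linarith) (h0.trans_le h)
    exact isLeg_spiral hε ⟨hφ₁, hAB.le.trans hφ₂⟩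
      (Real.cos_pos_of_mem_Ioo ⟨by linarith, by linarith⟩) _ h0 (le_min h01 h)
  · have hm0 : 0 < max s₀ (Real.sin A) := lt_max_of_lt_left h0
    refine IsLeg.glue hε (max_le h01 h.le) (fun h2 => ?_) (fun h2 => ?_) fun h2 h3 => ?_
    · have hu1 : min s₁ (Real.sin B) ≤ 1 := (min_le_right _ _).trans (Real.sin_le_one B)
      have hlu : max s₀ (Real.sin A) ≤ min s₁ (Real.sin B) := le_min (max_le h01 h.le) h2
      have e1 := Real.sin_arcsin (x := max s₀ (Real.sin A)) (by linarith) (hlu.trans hu1)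
      have e2 := Real.sin_arcsin (x := min s₁ (Real.sin B)) (by linarith) hu1
      rw [← e1, ← e2]
      refine isLeg_line hε (Real.arcsin_pos.2 hm0) (Real.monotone_arcsin hlu)
        (Real.arcsin_le_pi_div_two _) ?_ ?_
      · refine hφ₁.trans ?_
        rw [← hasinA]; exact Real.monotone_arcsin (by rw [hasinA]; exact le_max_right _ _)
      · refine le_trans ?_ hφ₂
        conv_rhs => rw [← hasinB]
        exact Real.monotone_arcsin (min_le_right _ _)
    · have hB2 : B < Real.pi / 2 := h1.resolve_left (not_le.2 h2)
      exact isLeg_spiral hε ⟨hφ₁.trans hAB.le, hφ₂⟩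
        (Real.cos_pos_of_mem_Ioo ⟨by linarith, hB2⟩) _ (lt_max_of_lt_left hm0)
        (max_le (max_le h01 h.le) h2.le)
    · have hB0 : 0 < B := pos_of_sin_pos (by linarith) (hm0.trans_le h2)
      obtain ⟨e1, e2⟩ := spiral_eq_line hB0 hB
      exact ⟨e1.symm, e2.symm⟩
  · have hA0 : 0 < A := pos_of_sin_pos (by linarith) (h0.trans_le h)
    rw [glue, glue, if_pos hle, if_pos hle]
    exact spiral_eq_line hA0 (hAB.le.trans hB)

/-! ### Bounds for the covector of a leg -/

theorem spiral_radial (α k s : ℝ) :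
    spiralPot α k s - s * spiralAngle α k s = 1 / Real.cos α - s * Real.tan α := by
  unfold spiralPot spiralAngle; ring

theorem leg_radial_cases (A B s : ℝ) :
    (s ≤ Real.sin A ∧ legPot A B s - s * legAngle A B s = 1 / Real.cos A - s * Real.tan A) ∨
    (Real.sin A ≤ s ∧ s ≤ Real.sin B ∧ legPot A B s - s * legAngle A B s = √(1 - s ^ 2)) ∨
    (Real.sin B ≤ s ∧ legPot A B s - s * legAngle A B s = 1 / Real.cos B - s * Real.tan B) := by
  unfold legPot legAngle glue
  rcases le_or_gt s (Real.sin A) with h | h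
  · left; rw [if_pos h, if_pos h, spiral_radial]; exact ⟨h, rfl⟩
  · right
    rw [if_neg h.not_ge, if_neg h.not_ge]
    rcases le_or_gt s (Real.sin B) with h' | h'
    · left; rw [if_pos h', if_pos h', linePot]; exact ⟨h.le, h', by ring⟩
    · right; rw [if_neg h'.not_ge, if_neg h'.not_ge, spiral_radial]; exact ⟨h'.le, rfl⟩

theorem spiral_radial_mul_cos {α : ℝ} (hcos : 0 < Real.cos α) (s b : ℝ) :
    ((1 / Real.cos α - s * Real.tan α) * Real.cos b + s * Real.sin b) * Real.cos α =
      Real.cos b + s * Real.sin (b - α) := by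
  rw [Real.tan_eq_sin_div_cos, Real.sin_sub]
  field_simp
  ring

/-- The covector takes the value one at bearing `α`. For `s ≤ sin α` its unconstrained optimum lies
below `α`, so `α` is best among the larger bearings. -/
theorem spiral_le_one_of_le {α s b : ℝ} (hcos : 0 < Real.cos α) (hs : s ≤ Real.sin α)
    (hb : α ≤ b) (hb' : b ≤ α + Real.pi) :
    (1 / Real.cos α - s * Real.tan α) * Real.cos b + s * Real.sin b ≤ 1 := by
  refine le_of_mul_le_mul_right ?_ hcos
  rw [spiral_radial_mul_cos hcos, one_mul]
  have h1 : 0 ≤ Real.sin (b - α) :=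
    Real.sin_nonneg_of_nonneg_of_le_pi (by linarith) (by linarith)
  have h2 : Real.cos b = Real.cos α * Real.cos (b - α) - Real.sin α * Real.sin (b - α) := by
    rw [← Real.cos_add]; congr 1; ring
  nlinarith [Real.cos_le_one (b - α), mul_le_mul_of_nonneg_right hs h1]

theorem spiral_le_one_of_ge {α s b : ℝ} (hcos : 0 < Real.cos α) (hs : Real.sin α ≤ s)
    (hb : b ≤ α) (hb' : α - Real.pi ≤ b) :
    (1 / Real.cos α - s * Real.tan α) * Real.cos b + s * Real.sin b ≤ 1 := by
  refine le_of_mul_le_mul_right ?_ hcos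
  rw [spiral_radial_mul_cos hcos, one_mul]
  have h1 : Real.sin (b - α) ≤ 0 :=
    Real.sin_nonpos_of_nonpos_of_neg_pi_le (by linarith) (by linarith)
  have h2 : Real.cos b = Real.cos α * Real.cos (b - α) - Real.sin α * Real.sin (b - α) := by
    rw [← Real.cos_add]; congr 1; ring
  nlinarith [Real.cos_le_one (b - α), mul_le_mul_of_nonpos_right hs h1]

theorem sqrt_mul_cos_add_le_one {s : ℝ} (hs : |s| ≤ 1) (b : ℝ) :
    |√(1 - s ^ 2) * Real.cos b + s * Real.sin b| ≤ 1 := by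
  have h1 : √(1 - s ^ 2) ^ 2 = 1 - s ^ 2 :=
    Real.sq_sqrt (by nlinarith [sq_abs s, abs_nonneg s])
  refine abs_le_one_iff_mul_self_le_one.2 ?_
  nlinarith [Real.sin_sq_add_cos_sq b,
    sq_nonneg (√(1 - s ^ 2) * Real.sin b - s * Real.cos b)]

/-- On the line the covector has unit norm; on a spiral the clipped bearing is the best one in `[A,
B]`. -/
theorem leg_le_one (hA : -(Real.pi / 2) ≤ A) (hAB : A < B) (hB : B ≤ Real.pi / 2) {s : ℝ}
    (hs : 0 < s) (hsB : s ≤ Real.sin B ∨ B < Real.pi / 2) {b : ℝ} (hb : A ≤ b) (hb' : b ≤ B) :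
    (legPot A B s - s * legAngle A B s) * Real.cos b + s * Real.sin b ≤ 1 := by
  have hpi := Real.pi_pos
  have hline : s ≤ Real.sin B → √(1 - s ^ 2) * Real.cos b + s * Real.sin b ≤ 1 := fun h =>
    (le_abs_self _).trans (sqrt_mul_cos_add_le_one (by
      rw [abs_of_pos hs]; exact h.trans (Real.sin_le_one B)) b)
  rcases leg_radial_cases A B s with ⟨h, e⟩ | ⟨h, h', e⟩ | ⟨h, e⟩ <;> rw [e]
  · have hA0 : 0 < A := pos_of_sin_pos (by linarith) (hs.trans_le h)
    exact spiral_le_one_of_le (Real.cos_pos_of_mem_Ioo ⟨by linarith, by linarith⟩) h hb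
      (by linarith)
  · exact hline h'
  · rcases hsB with h2 | h2
    · obtain rfl : s = Real.sin B := le_antisymm h2 h
      have hB0 : 0 < B := pos_of_sin_pos (by linarith) hs
      obtain ⟨e1, e2⟩ := spiral_eq_line hB0 hB
      have := hline le_rfl
      rw [← spiral_radial B (spiralConst B), e1, e2, linePot, add_sub_cancel_right]
      exact this
    · exact spiral_le_one_of_ge (Real.cos_pos_of_mem_Ioo ⟨by linarith, h2⟩) h hb' (by linarith)

theorem continuous_spiralPot (α k : ℝ) : Continuous (spiralPot α k) := by
  have : spiralPot α k = fun s => 1 / Real.cos α + (Real.tan α * (s * Real.log s) +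
      s * (k - Real.tan α)) := by
    funext s; unfold spiralPot; ring
  rw [this]
  have := Real.continuous_mul_log
  fun_prop

theorem tendsto_glue_of_pos {c : ℝ} {f g : ℝ → ℝ} {l : ℝ} (hc : 0 < c)
    (hf : Filter.Tendsto f (nhdsWithin 0 (Ioi 0)) (nhds l)) :
    Filter.Tendsto (glue c f g) (nhdsWithin 0 (Ioi 0)) (nhds l) := by
  refine hf.congr' ?_
  filter_upwards [Ioo_mem_nhdsGT hc] with t ht
  rw [glue, if_pos ht.2.le]

theorem tendsto_glue_of_nonpos {c : ℝ} {f g : ℝ → ℝ} {l : ℝ} (hc : c ≤ 0)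
    (hg : Filter.Tendsto g (nhdsWithin 0 (Ioi 0)) (nhds l)) :
    Filter.Tendsto (glue c f g) (nhdsWithin 0 (Ioi 0)) (nhds l) := by
  refine hg.congr' ?_
  filter_upwards [self_mem_nhdsWithin] with t ht
  rw [glue, if_neg (not_le.2 (hc.trans_lt ht))]

theorem tendsto_spiralPot (α k : ℝ) :
    Filter.Tendsto (spiralPot α k) (nhdsWithin 0 (Ioi 0)) (nhds (1 / Real.cos α)) := by
  have := ((continuous_spiralPot α k).tendsto 0).mono_left (nhdsWithin_le_nhds (s := Ioi 0))
  simpa [spiralPot] using this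

theorem tendsto_linePot : Filter.Tendsto linePot (nhdsWithin 0 (Ioi 0)) (nhds 1) := by
  have := (continuous_linePot.tendsto 0).mono_left (nhdsWithin_le_nhds (s := Ioi 0))
  simpa [linePot] using this

theorem tendsto_legPot_of_pos (hA : 0 < A) (hA' : A < Real.pi) :
    Filter.Tendsto (legPot A B) (nhdsWithin 0 (Ioi 0)) (nhds (1 / Real.cos A)) :=
  tendsto_glue_of_pos (Real.sin_pos_of_pos_of_lt_pi hA hA') (tendsto_spiralPot _ _)

theorem tendsto_legPot_of_nonpos_of_pos (hA : A ≤ 0) (hA' : -Real.pi ≤ A) (hB : 0 < B)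
    (hB' : B < Real.pi) : Filter.Tendsto (legPot A B) (nhdsWithin 0 (Ioi 0)) (nhds 1) :=
  tendsto_glue_of_nonpos (Real.sin_nonpos_of_nonpos_of_neg_pi_le hA hA')
    (tendsto_glue_of_pos (Real.sin_pos_of_pos_of_lt_pi hB hB') tendsto_linePot)

theorem tendsto_legPot_of_nonpos (hA : A ≤ 0) (hA' : -Real.pi ≤ A) (hB : B ≤ 0)
    (hB' : -Real.pi ≤ B) :
    Filter.Tendsto (legPot A B) (nhdsWithin 0 (Ioi 0)) (nhds (1 / Real.cos B)) :=
  tendsto_glue_of_nonpos (Real.sin_nonpos_of_nonpos_of_neg_pi_le hA hA')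
    (tendsto_glue_of_nonpos (Real.sin_nonpos_of_nonpos_of_neg_pi_le hB hB')
      (tendsto_spiralPot _ _))

end leg

/-! ### Extremal pairs -/

theorem Reach.halfTurn_symm {ε φ₁ φ₂ ρ₀ ψ₀ ρ₁ ψ₁ ℓ : ℝ}
    (h : Reach ε (φ₁ + Real.pi) (φ₂ + Real.pi) ρ₀ ψ₀ ρ₁ ψ₁ ℓ) :
    Reach ε φ₁ φ₂ ρ₀ ψ₀ ρ₁ ψ₁ ℓ := by
  convert h.mirror.halfTurn.mirror using 1 <;> ring

theorem IsLeg.halfTurn_symm {ε φ₁ φ₂ s₀ s₁ : ℝ} {Φ T : ℝ → ℝ}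
    (h : IsLeg ε (φ₁ + Real.pi) (φ₂ + Real.pi) Φ T s₀ s₁) : IsLeg ε φ₁ φ₂ Φ T s₀ s₁ :=
  fun P hP ψ => (h P hP ψ).halfTurn_symm

/-- Potentials `Φ` for the inward part and `Φ'` for the outward part of the extremals, for values
of the momentum quotient up to `S`, that calibrate and are realized by motions. -/
structure IsExtremalPair (ε φ₁ φ₂ S : ℝ) (Φ T Φ' T' : ℝ → ℝ) : Prop where
  pos : 0 < S
  inward : IsCalibrating φ₁ φ₂ S Φ T
  outward : IsCalibrating (-φ₂) (-φ₁) S Φ' T'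
  leg_inward : ∀ s₀ s₁, 0 < s₀ → s₀ ≤ s₁ → s₁ ≤ S → IsLeg ε φ₁ φ₂ Φ T s₀ s₁
  leg_outward : ∀ s₀ s₁, 0 < s₀ → s₀ ≤ s₁ → s₁ ≤ S → IsLeg ε (-φ₂) (-φ₁) Φ' T' s₀ s₁
  gap_nonneg : 0 ≤ (Φ S - S * T S) + (Φ' S - S * T' S)
  gap : (Φ S - S * T S) + (Φ' S - S * T' S) = 0 ∨ Real.pi / 2 ∈ Icc φ₁ φ₂ ∧ S = 1
  limit : Filter.Tendsto (fun s => Φ s + Φ' s) (nhdsWithin 0 (Ioi 0))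
    (nhds (2 / Real.cos (max φ₁ 0)))

theorem spiral_radial_ge {α G D S s : ℝ} (hα : 0 < Real.cos α) (hG : 0 < Real.cos G)
    (hD' : D ≤ Real.pi / 2) (hαG : α - G ≤ D) (hαG' : -(Real.pi / 2) ≤ α - G)
    (hS : S * Real.sin D = Real.cos G) (hs : 0 < s) (hsS : s ≤ S) (hsinD : 0 < Real.sin D) :
    -(s * Real.tan G) ≤ 1 / Real.cos α - s * Real.tan α := by
  have h1 : Real.sin (α - G) ≤ Real.sin D :=
    Real.sin_le_sin_of_le_of_le_pi_div_two hαG' hD' hαG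
  have h2 : s * Real.sin (α - G) ≤ Real.cos G := by
    rw [← hS]
    nlinarith [mul_le_mul_of_nonneg_left h1 hs.le, mul_le_mul_of_nonneg_right hsS hsinD.le]
  rw [Real.sin_sub] at h2
  rw [← sub_nonneg, Real.tan_eq_sin_div_cos, Real.tan_eq_sin_div_cos]
  have : 1 / Real.cos α - s * (Real.sin α / Real.cos α) - -(s * (Real.sin G / Real.cos G)) =
      (Real.cos G - s * (Real.sin α * Real.cos G - Real.cos α * Real.sin G)) /
        (Real.cos α * Real.cos G) := by
    field_simp
    ring
  rw [this]
  exact div_nonneg (by linarith) (by positivity)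

/-- With radial part `-s tan G` the covector is orthogonal to the axis `G` and its value is `s sin
(b - G) / cos G`. The normalization `S sin D = cos G` keeps this in `[-1, 1]` on the cone for all `s
≤ S`. -/
theorem neg_one_le_of_radial_ge {a b G D S s : ℝ} (hb : 0 ≤ Real.cos b) (hG : 0 < Real.cos G)
    (hD' : D ≤ Real.pi / 2) (hbG : -D ≤ b - G) (hbG' : b - G ≤ Real.pi / 2)
    (hS : S * Real.sin D = Real.cos G) (hs : 0 < s) (hsS : s ≤ S) (hsinD : 0 < Real.sin D)
    (ha : -(s * Real.tan G) ≤ a) : -1 ≤ a * Real.cos b + s * Real.sin b := by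
  have h1 : -Real.sin D ≤ Real.sin (b - G) := by
    rw [← Real.sin_neg]
    exact Real.sin_le_sin_of_le_of_le_pi_div_two (by linarith) hbG' hbG
  have h2 : -Real.cos G ≤ s * Real.sin (b - G) := by
    rw [← hS]
    nlinarith [mul_le_mul_of_nonneg_left h1 hs.le, mul_le_mul_of_nonneg_right hsS hsinD.le]
  have h3 : -(s * Real.tan G) * Real.cos b ≤ a * Real.cos b := mul_le_mul_of_nonneg_right ha hb
  have h4 : -(s * Real.tan G) * Real.cos b + s * Real.sin b =
      s * Real.sin (b - G) / Real.cos G := by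
    rw [Real.sin_sub, Real.tan_eq_sin_div_cos]; field_simp; ring
  have h5 : -1 ≤ s * Real.sin (b - G) / Real.cos G := by
    rw [le_div_iff₀ hG]; linarith
  linarith

theorem radial_le_of_le_one {a b G D S : ℝ} (hb : 0 < Real.cos b) (hG : 0 < Real.cos G)
    (hbG : b - G = D) (hS : S * Real.sin D = Real.cos G)
    (h : a * Real.cos b + S * Real.sin b ≤ 1) : a ≤ -(S * Real.tan G) := by
  refine le_of_mul_le_mul_right ?_ (mul_pos hb hG)
  have h1 : S * (Real.sin b * Real.cos G - Real.cos b * Real.sin G) = Real.cos G := by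
    rw [← Real.sin_sub, hbG, hS]
  have h2 : -(S * Real.tan G) * (Real.cos b * Real.cos G) =
      -(S * Real.sin G * Real.cos b) := by
    rw [Real.tan_eq_sin_div_cos]; field_simp
  rw [h2]
  nlinarith

/-- The limit `S` is where the radial part reaches `-S tan Γ` and the two edges of the cone give `1`
and `-1`. If `Γ + D < π / 2`, the inward and outward covectors then match and the gap vanishes; if
`Γ + D = π / 2`, then `S = 1` and a circular arc can fill the gap. -/
theorem isExtremalPair_front {ε Γ D : ℝ} (hε : 0 < ε) (hD : 0 < D) (hD' : D ≤ Real.pi / 4)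
    (hΓ : 0 ≤ Γ) (hφ₂ : Γ + D ≤ Real.pi / 2) :
    IsExtremalPair ε (Γ - D) (Γ + D) (Real.cos Γ / Real.sin D)
      (legPot (Γ - D) (Γ + D)) (legAngle (Γ - D) (Γ + D))
      (legPot (-(Γ + D)) (-(Γ - D))) (legAngle (-(Γ + D)) (-(Γ - D))) := by
  have hpi := Real.pi_pos
  have hcosΓ : 0 < Real.cos Γ := Real.cos_pos_of_mem_Ioo ⟨by linarith, by linarith⟩
  have hsinD : 0 < Real.sin D := Real.sin_pos_of_pos_of_lt_pi hD (by linarith)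
  have htan : 0 ≤ Real.tan Γ := Real.tan_nonneg_of_nonneg_of_le_pi_div_two hΓ (by linarith)
  set S := Real.cos Γ / Real.sin D with hS
  have hSpos : 0 < S := by positivity
  have hSD : S * Real.sin D = Real.cos Γ := by rw [hS]; field_simp
  have hcosΓ' : 0 < Real.cos (-Γ) := by rwa [Real.cos_neg]
  have hSD' : S * Real.sin D = Real.cos (-Γ) := by rw [Real.cos_neg, hSD]
  have hcos₁ : 0 < Real.cos (Γ - D) := Real.cos_pos_of_mem_Ioo ⟨by linarith, by linarith⟩
  have hS1 : Γ + D = Real.pi / 2 → S = 1 := fun h => by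
    rw [hS, show Γ = Real.pi / 2 - D by linarith, Real.cos_pi_div_two_sub, div_self hsinD.ne']
  have hend : ∀ s ≤ S, s ≤ Real.sin (Γ + D) ∨ Γ + D < Real.pi / 2 := fun s hs => by
    rcases eq_or_lt_of_le hφ₂ with h | h
    · left; rw [h, Real.sin_pi_div_two, ← hS1 h]; exact hs
    · exact Or.inr h
  have hge : ∀ s, 0 < s → s ≤ S → -(s * Real.tan Γ) ≤
      legPot (Γ - D) (Γ + D) s - s * legAngle (Γ - D) (Γ + D) s := fun s hs hsS => by
    rcases leg_radial_cases (Γ - D) (Γ + D) s with ⟨h, e⟩ | ⟨h, h', e⟩ | ⟨h, e⟩ <;> rw [e]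
    · exact spiral_radial_ge hcos₁ hcosΓ (by linarith) (by linarith) (by linarith) hSD hs hsS hsinD
    · have := Real.sqrt_nonneg (1 - s ^ 2)
      nlinarith [mul_nonneg hs.le htan]
    · rcases eq_or_lt_of_le hφ₂ with h2 | h2
      · rw [h2, Real.cos_pi_div_two, Real.tan_pi_div_two]
        simp only [div_zero, mul_zero, sub_zero]
        nlinarith [mul_nonneg hs.le htan]
      · exact spiral_radial_ge (Real.cos_pos_of_mem_Ioo ⟨by linarith, by linarith⟩) hcosΓ
          (by linarith) (by linarith) (by linarith) hSD hs hsS hsinD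
  have hge' : ∀ s, 0 < s → s ≤ S → -(s * Real.tan (-Γ)) ≤
      legPot (-(Γ + D)) (-(Γ - D)) s - s * legAngle (-(Γ + D)) (-(Γ - D)) s := fun s hs hsS => by
    rcases leg_radial_cases (-(Γ + D)) (-(Γ - D)) s with ⟨h, e⟩ | ⟨h, h', e⟩ | ⟨h, e⟩ <;> rw [e]
    · exact absurd (h.trans (Real.sin_nonpos_of_nonpos_of_neg_pi_le (by linarith) (by linarith)))
        (not_le.2 hs)
    · rw [Real.tan_neg, mul_neg, neg_neg, Real.tan_eq_sin_div_cos]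
      rw [Real.sin_neg] at h'
      have h1 : Real.cos (Γ - D) ≤ √(1 - s ^ 2) := by
        refine Real.le_sqrt_of_sq_le ?_
        nlinarith [Real.sin_sq_add_cos_sq (Γ - D)]
      have h2 : 0 ≤ Real.cos D := Real.cos_nonneg_of_mem_Icc ⟨by linarith, by linarith⟩
      have h3 : Real.cos D = Real.cos Γ * Real.cos (Γ - D) + Real.sin Γ * Real.sin (Γ - D) := by
        rw [← Real.cos_sub]; congr 1; ring
      have h4 : 0 ≤ Real.sin Γ := Real.sin_nonneg_of_nonneg_of_le_pi hΓ (by linarith)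
      rw [← mul_div_assoc, div_le_iff₀ hcosΓ]
      nlinarith [mul_le_mul_of_nonneg_right h1 hcosΓ.le, mul_le_mul_of_nonneg_right h' h4]
    · exact spiral_radial_ge (by rwa [Real.cos_neg]) hcosΓ' (by linarith) (by linarith)
        (by linarith) hSD' hs hsS hsinD
  refine ⟨hSpos, ⟨fun s hs => hasDerivAt_legPot (by linarith) (by linarith) hφ₂ hs,
    fun s hs hsS b hb hb' => abs_le.2 ⟨?_, ?_⟩⟩,
    ⟨fun s hs => hasDerivAt_legPot (by linarith) (by linarith) (by linarith) hs,
    fun s hs hsS b hb hb' => abs_le.2 ⟨?_, ?_⟩⟩, ?_, ?_, ?_, ?_, ?_⟩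
  · exact neg_one_le_of_radial_ge (Real.cos_nonneg_of_mem_Icc ⟨by linarith, by linarith⟩) hcosΓ
      (by linarith) (by linarith) (by linarith) hSD hs hsS hsinD (hge s hs hsS)
  · exact leg_le_one (by linarith) (by linarith) hφ₂ hs (hend s hsS) hb hb'
  · exact neg_one_le_of_radial_ge (Real.cos_nonneg_of_mem_Icc ⟨by linarith, by linarith⟩) hcosΓ'
      (by linarith) (by linarith) (by linarith) hSD' hs hsS hsinD (hge' s hs hsS)
  · exact leg_le_one (by linarith) (by linarith) (by linarith) hs (Or.inr (by linarith)) hb hb'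
  · exact fun s₀ s₁ h0 h01 h1 => isLeg_leg hε (by linarith) (by linarith) hφ₂ le_rfl le_rfl h0 h01
      (hend s₁ h1)
  · exact fun s₀ s₁ h0 h01 h1 => isLeg_leg hε (by linarith) (by linarith) (by linarith) le_rfl
      le_rfl h0 h01 (Or.inr (by linarith))
  · have h1 := hge S hSpos le_rfl
    have h2 := hge' S hSpos le_rfl
    rw [Real.tan_neg] at h2
    linarith
  · rcases eq_or_lt_of_le hφ₂ with h | h
    · exact Or.inr ⟨⟨by linarith, h.ge⟩, hS1 h⟩
    · left
      have h1 := hge S hSpos le_rfl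
      have h2 := hge' S hSpos le_rfl
      -- The upper bound one, tested at the edge of the cone, is the reverse of `hge` at `S`.
      have h3 := radial_le_of_le_one (b := Γ + D) (G := Γ) (D := D) (S := S)
        (Real.cos_pos_of_mem_Ioo ⟨by linarith, h⟩) hcosΓ (by ring) hSD
        (leg_le_one (by linarith) (by linarith) hφ₂ hSpos (hend S le_rfl)
          (show Γ - D ≤ Γ + D by linarith) le_rfl)
      have h4 := radial_le_of_le_one (b := -(Γ - D)) (G := -Γ) (D := D) (S := S)
        (by rwa [Real.cos_neg]) hcosΓ' (by ring) hSD'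
        (leg_le_one (by linarith) (by linarith) (by linarith) hSpos (Or.inr (by linarith))
          (show -(Γ + D) ≤ -(Γ - D) by linarith) le_rfl)
      rw [Real.tan_neg] at h2 h4
      linarith
  · rcases lt_or_ge 0 (Γ - D) with h | h
    · rw [max_eq_left h.le]
      have h1 := tendsto_legPot_of_pos (B := Γ + D) h (by linarith)
      have h2 := tendsto_legPot_of_nonpos (A := -(Γ + D)) (B := -(Γ - D)) (by linarith)
        (by linarith) (by linarith) (by linarith)
      rw [Real.cos_neg] at h2
      convert h1.add h2 using 2
      ring
    · rw [max_eq_right h, Real.cos_zero]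
      have h1 := tendsto_legPot_of_nonpos_of_pos (A := Γ - D) (B := Γ + D) h (by linarith)
        (by linarith) (by linarith)
      rcases eq_or_lt_of_le h with h0 | h0
      · have h2 := tendsto_legPot_of_nonpos (A := -(Γ + D)) (B := -(Γ - D)) (by linarith)
          (by linarith) (by linarith) (by linarith)
        rw [Real.cos_neg, h0, Real.cos_zero] at h2
        rw [h0] at h1 ⊢
        convert h1.add h2 using 2
        norm_num
      · have h2 := tendsto_legPot_of_nonpos_of_pos (A := -(Γ + D)) (B := -(Γ - D)) (by linarith)
          (by linarith) (by linarith) (by linarith)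
        convert h1.add h2 using 2
        norm_num

theorem sin_le_cos_of_le {Γ D c x : ℝ} (hΓ : 0 ≤ Γ) (hΓ' : Γ ≤ Real.pi / 2) (hD : 0 < D)
    (hD' : D ≤ Real.pi / 4) (hc : c * Real.sin D = Real.cos Γ) (hx : 0 ≤ x) (hxD : x ≤ D) :
    c * Real.sin x ≤ Real.cos (Γ - D + x) := by
  have hpi := Real.pi_pos
  have hsinD : 0 < Real.sin D := Real.sin_pos_of_pos_of_lt_pi hD (by linarith)
  have hcosD : 0 ≤ Real.cos D := Real.cos_nonneg_of_mem_Icc ⟨by linarith, by linarith⟩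
  have hcosΓ : 0 ≤ Real.cos Γ := Real.cos_nonneg_of_mem_Icc ⟨by linarith, by linarith⟩
  have hsinΓ : 0 ≤ Real.sin Γ := Real.sin_nonneg_of_nonneg_of_le_pi hΓ (by linarith)
  have hy : 0 ≤ Real.sin (D - x) := Real.sin_nonneg_of_nonneg_of_le_pi (by linarith) (by linarith)
  have e1 : Real.sin x = Real.sin D * Real.cos (D - x) - Real.cos D * Real.sin (D - x) := by
    rw [← Real.sin_sub]; congr 1; ring
  have e2 : Real.cos (Γ - D + x) = Real.cos Γ * Real.cos (D - x) +
      Real.sin Γ * Real.sin (D - x) := by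
    rw [← Real.cos_sub]; congr 1; ring
  refine le_of_mul_le_mul_right ?_ hsinD
  rw [show c * Real.sin x * Real.sin D = Real.cos Γ * Real.sin x by rw [← hc]; ring, e1, e2]
  nlinarith [mul_nonneg (mul_nonneg hcosΓ hcosD) hy, mul_nonneg (mul_nonneg hsinΓ hsinD.le) hy]

/-- Equality holds at `x = D`, which corresponds to the opposite edge of the cone; together with
`sin_le_cos_of_le` this identifies `c = cos Γ / sin D` as the switching value between the two
spirals. -/
theorem cos_le_sin_of_le {Γ D c x : ℝ} (hD : 0 < D)
    (hD' : D ≤ Real.pi / 4) (hφ₂ : Real.cos (Γ + D) ≤ 0) (hc : c * Real.sin D = Real.cos Γ)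
    (hx : 0 ≤ x) (hxD : x ≤ D) : Real.cos (Γ + D - x) ≤ c * Real.sin x := by
  have hpi := Real.pi_pos
  have hsinD : 0 < Real.sin D := Real.sin_pos_of_pos_of_lt_pi hD (by linarith)
  have hy : 0 ≤ Real.sin (D - x) := Real.sin_nonneg_of_nonneg_of_le_pi (by linarith) (by linarith)
  have e1 : Real.sin x = Real.sin D * Real.cos (D - x) - Real.cos D * Real.sin (D - x) := by
    rw [← Real.sin_sub]; congr 1; ring
  have e2 : Real.cos (Γ + D - x) = Real.cos Γ * Real.cos (D - x) -
      Real.sin Γ * Real.sin (D - x) := by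
    rw [← Real.cos_add]; congr 1; ring
  rw [Real.cos_add] at hφ₂
  refine le_of_mul_le_mul_right ?_ hsinD
  rw [show c * Real.sin x * Real.sin D = Real.cos Γ * Real.sin x by rw [← hc]; ring, e1, e2]
  nlinarith [mul_nonneg (sub_nonneg.2 hφ₂) hy]

theorem leg_radial_nonneg {A s : ℝ} (hA : 0 < A) (hA' : A < Real.pi / 2) :
    0 ≤ legPot A (Real.pi / 2) s - s * legAngle A (Real.pi / 2) s := by
  have hcos : 0 < Real.cos A := Real.cos_pos_of_mem_Ioo ⟨by linarith, hA'⟩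
  rcases leg_radial_cases A (Real.pi / 2) s with ⟨h, e⟩ | ⟨h, h', e⟩ | ⟨h, e⟩ <;> rw [e]
  · have hsin : 0 < Real.sin A := Real.sin_pos_of_pos_of_lt_pi hA (by linarith)
    rw [Real.tan_eq_sin_div_cos, mul_div_assoc', ← sub_div]
    exact div_nonneg (by nlinarith [Real.sin_le_one A]) hcos.le
  · exact Real.sqrt_nonneg _
  · simp

theorem leg_radial_one {A : ℝ} (hA : 0 < A) (hA' : A < Real.pi / 2) :
    legPot A (Real.pi / 2) 1 - 1 * legAngle A (Real.pi / 2) 1 = 0 := by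
  rcases leg_radial_cases A (Real.pi / 2) 1 with ⟨h, e⟩ | ⟨h, h', e⟩ | ⟨h, e⟩ <;> rw [e]
  · have := Real.sin_lt_sin_of_lt_of_le_pi_div_two (by linarith) le_rfl hA'
    rw [Real.sin_pi_div_two] at this
    linarith
  · norm_num
  · simp

/-- The potential of the outward part of the extremals when the cone contains the lateral direction
in its interior: beyond `c` it is a forward motion, before `c` a backward spiral. -/
noncomputable def lateralPot (c φ₁ φ₂ : ℝ) : ℝ → ℝ :=
  glue c (spiralPot (-φ₁) (legAngle (Real.pi - φ₂) (Real.pi / 2) c -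
    Real.tan (-φ₁) * Real.log c)) (legPot (Real.pi - φ₂) (Real.pi / 2))

/-- The polar angle that belongs to `lateralPot`. -/
noncomputable def lateralAngle (c φ₁ φ₂ : ℝ) : ℝ → ℝ :=
  glue c (spiralAngle (-φ₁) (legAngle (Real.pi - φ₂) (Real.pi / 2) c -
    Real.tan (-φ₁) * Real.log c)) (legAngle (Real.pi - φ₂) (Real.pi / 2))

/-- Bearings beyond `π / 2` are reflected to `π - b`, which is at least `φ₁` because `φ₁ + φ₂ ≤ π`.
Both coefficients are nonnegative, so reflection settles the remaining signs. -/
theorem lateral_inward_bound {φ₁ φ₂ s b : ℝ} (h1 : 0 < φ₁) (h1' : φ₁ < Real.pi / 2)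
    (h12 : φ₁ + φ₂ ≤ Real.pi) (hs : 0 < s) (hs1 : s ≤ 1) (hb : φ₁ ≤ b) (hb' : b ≤ φ₂) :
    |(legPot φ₁ (Real.pi / 2) s - s * legAngle φ₁ (Real.pi / 2) s) * Real.cos b +
      s * Real.sin b| ≤ 1 := by
  have ha := leg_radial_nonneg (s := s) h1 h1'
  set a := legPot φ₁ (Real.pi / 2) s - s * legAngle φ₁ (Real.pi / 2) s with hadef
  have hsin : 0 ≤ Real.sin b := Real.sin_nonneg_of_nonneg_of_le_pi (by linarith) (by linarith)
  have hss := mul_nonneg hs.le hsin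
  have hss1 : s * Real.sin b ≤ 1 := mul_le_one₀ hs1 hsin (Real.sin_le_one b)
  have hend : s ≤ Real.sin (Real.pi / 2) ∨ Real.pi / 2 < Real.pi / 2 := by
    left; rwa [Real.sin_pi_div_two]
  rcases le_or_gt b (Real.pi / 2) with hc | hc
  · have hcos : 0 ≤ Real.cos b := Real.cos_nonneg_of_mem_Icc ⟨by linarith, hc⟩
    exact abs_le.2 ⟨by linarith [mul_nonneg ha hcos],
      leg_le_one (by linarith) h1' le_rfl hs hend hb hc⟩
  · have hcos : Real.cos b ≤ 0 := Real.cos_nonpos_of_pi_div_two_le_of_le hc.le (by linarith)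
    have := leg_le_one (by linarith) h1' le_rfl hs hend (b := Real.pi - b) (by linarith)
      (by linarith)
    rw [Real.cos_pi_sub, Real.sin_pi_sub, ← hadef] at this
    exact abs_le.2 ⟨by linarith, by linarith [mul_nonneg ha (neg_nonneg.2 hcos)]⟩

theorem lateral_outward_bound {Γ D c s b : ℝ} (hD : 0 < D) (hD' : D ≤ Real.pi / 4)
    (hΓ' : Γ ≤ Real.pi / 2) (hφ₂ : Real.pi / 2 < Γ + D) (hc : c * Real.sin D = Real.cos Γ)
    (hcs : c ≤ s) (hs : 0 < s) (hs1 : s ≤ 1) (hb : Γ - D ≤ b) (hb' : b ≤ Γ + D) :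
    |(legPot (Real.pi - (Γ + D)) (Real.pi / 2) s -
      s * legAngle (Real.pi - (Γ + D)) (Real.pi / 2) s) * Real.cos b - s * Real.sin b| ≤ 1 := by
  have hA : 0 < Real.pi - (Γ + D) := by linarith
  have hA' : Real.pi - (Γ + D) < Real.pi / 2 := by linarith
  have ha := leg_radial_nonneg (s := s) hA hA'
  have hend : s ≤ Real.sin (Real.pi / 2) ∨ Real.pi / 2 < Real.pi / 2 := by
    left; rwa [Real.sin_pi_div_two]
  have hle := fun b => leg_le_one (by linarith) hA' le_rfl hs hend (b := b)
  have hcases := leg_radial_cases (Real.pi - (Γ + D)) (Real.pi / 2) s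
  set a := legPot (Real.pi - (Γ + D)) (Real.pi / 2) s -
      s * legAngle (Real.pi - (Γ + D)) (Real.pi / 2) s with hadef
  have hsin : 0 ≤ Real.sin b := Real.sin_nonneg_of_nonneg_of_le_pi (by linarith) (by linarith)
  have hss := mul_nonneg hs.le hsin
  have hss1 : s * Real.sin b ≤ 1 := mul_le_one₀ hs1 hsin (Real.sin_le_one b)
  rcases le_or_gt (Real.pi / 2) b with h2 | h2
  · have hcos : Real.cos b ≤ 0 := Real.cos_nonpos_of_pi_div_two_le_of_le h2 (by linarith)
    have := hle (Real.pi - b) (by linarith) (by linarith)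
    rw [Real.cos_pi_sub, Real.sin_pi_sub] at this
    exact abs_le.2 ⟨by linarith, by linarith [mul_nonneg ha (neg_nonneg.2 hcos)]⟩
  · have hcos : 0 ≤ Real.cos b := Real.cos_nonneg_of_mem_Icc ⟨by linarith, h2.le⟩
    have hac := mul_nonneg ha hcos
    refine abs_le.2 ⟨by linarith, ?_⟩
    rcases le_or_gt (Real.pi - (Γ + D)) b with h3 | h3
    · linarith [hle b h3 h2.le]
    -- The reflected bearing now lies outside the clipped range. On the spiral, sum-to-product
    -- formulas reduce the bound to `cos_le_sin_of_le` at the half-angle, and `c ≤ s` is essential.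
    · rcases hcases with ⟨h, e⟩ | ⟨h, h', e⟩ | ⟨h, e⟩
      · have hcosA : 0 < Real.cos (Real.pi - (Γ + D)) :=
          Real.cos_pos_of_mem_Ioo ⟨by linarith, hA'⟩
        have hmul := spiral_radial_mul_cos hcosA s (-b)
        rw [← e, Real.cos_neg, Real.sin_neg] at hmul
        refine le_of_mul_le_mul_right ?_ hcosA
        have hx := cos_le_sin_of_le (x := (Γ + D - b) / 2) hD hD'
          (Real.cos_nonpos_of_pi_div_two_le_of_le hφ₂.le (by linarith)) hc (by linarith)
          (by linarith)
        have hxcos : 0 ≤ Real.cos ((Γ + D - b) / 2) :=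
          Real.cos_nonneg_of_mem_Icc ⟨by linarith, by linarith⟩
        have hxsin : 0 ≤ Real.sin ((Γ + D - b) / 2) :=
          Real.sin_nonneg_of_nonneg_of_le_pi (by linarith) (by linarith)
        have e1 : Real.sin (-b - (Real.pi - (Γ + D))) =
            -(2 * Real.sin ((Γ + D - b) / 2) * Real.cos ((Γ + D - b) / 2)) := by
          rw [← Real.sin_two_mul, ← Real.sin_sub_pi]; congr 1; ring
        have e2 : Real.cos b + Real.cos (Γ + D) =
            2 * Real.cos (Γ + D - (Γ + D - b) / 2) * Real.cos ((Γ + D - b) / 2) := by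
          rw [add_comm, Real.cos_add_cos]; congr 2; ring_nf
        rw [e1] at hmul
        rw [Real.cos_pi_sub] at hmul ⊢
        have h5 : Real.cos (Γ + D - (Γ + D - b) / 2) * Real.cos ((Γ + D - b) / 2) ≤
            s * Real.sin ((Γ + D - b) / 2) * Real.cos ((Γ + D - b) / 2) :=
          mul_le_mul_of_nonneg_right (hx.trans (mul_le_mul_of_nonneg_right hcs hxsin)) hxcos
        linarith
      · have := (abs_le.1 (sqrt_mul_cos_add_le_one (s := s) (by rwa [abs_of_pos hs]) (-b))).2
        rw [Real.cos_neg, Real.sin_neg] at this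
        rw [e]; linarith
      · rw [e, Real.cos_pi_div_two, Real.tan_pi_div_two]
        simp only [div_zero, mul_zero, sub_zero, zero_mul, zero_sub]
        linarith

theorem lateral_backward_bound {Γ D c s b : ℝ} (hD : 0 < D) (hD' : D ≤ Real.pi / 4) (hΓ : 0 ≤ Γ)
    (hΓ' : Γ ≤ Real.pi / 2) (hφ₁ : 0 < Γ - D)
    (hc : c * Real.sin D = Real.cos Γ)
    (hcs : s ≤ c) (hs : 0 < s) (hb : -(Γ + D) ≤ b) (hb' : b ≤ -(Γ - D)) :
    |(1 / Real.cos (-(Γ - D)) - s * Real.tan (-(Γ - D))) * Real.cos b + s * Real.sin b| ≤ 1 := by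
  have hpi := Real.pi_pos
  have hcos : 0 < Real.cos (-(Γ - D)) := Real.cos_pos_of_mem_Ioo ⟨by linarith, by linarith⟩
  refine abs_le.2 ⟨?_, spiral_le_one_of_ge hcos ?_ hb' (by linarith)⟩
  · refine le_of_mul_le_mul_right ?_ hcos
    rw [spiral_radial_mul_cos hcos]
    have hx := sin_le_cos_of_le (x := (-b - (Γ - D)) / 2) hΓ hΓ' hD hD' hc (by linarith)
      (by linarith)
    have hxcos : 0 ≤ Real.cos ((-b - (Γ - D)) / 2) :=
      Real.cos_nonneg_of_mem_Icc ⟨by linarith, by linarith⟩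
    have hxsin : 0 ≤ Real.sin ((-b - (Γ - D)) / 2) :=
      Real.sin_nonneg_of_nonneg_of_le_pi (by linarith) (by linarith)
    have e1 : Real.sin (b - -(Γ - D)) =
        -(2 * Real.sin ((-b - (Γ - D)) / 2) * Real.cos ((-b - (Γ - D)) / 2)) := by
      rw [← Real.sin_two_mul, ← Real.sin_neg]; congr 1; ring
    have e2 : Real.cos b + Real.cos (-(Γ - D)) =
        2 * Real.cos (Γ - D + (-b - (Γ - D)) / 2) * Real.cos ((-b - (Γ - D)) / 2) := by
      rw [← Real.cos_neg b, Real.cos_neg (Γ - D), Real.cos_add_cos]; congr 2; ring_nf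
    rw [e1]
    have h5 := mul_le_mul_of_nonneg_right ((mul_le_mul_of_nonneg_right hcs hxsin).trans hx) hxcos
    linarith
  · refine le_trans ?_ hs.le
    exact Real.sin_nonpos_of_nonpos_of_neg_pi_le (by linarith) (by linarith)

/-- The constant `k` makes the angles agree; the values agree because at `c` the radial coefficients
of the backward spiral at `φ₁` and the forward spiral at `φ₂` coincide. -/
theorem lateral_match {Γ D c : ℝ} (hD : 0 < D) (hD' : D ≤ Real.pi / 4)
    (hΓ' : Γ ≤ Real.pi / 2) (hφ₁ : 0 < Γ - D) (hφ₂ : Real.pi / 2 < Γ + D)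
    (hc : c * Real.sin D = Real.cos Γ) (hcφ : c ≤ Real.sin (Γ + D)) :
    let k := legAngle (Real.pi - (Γ + D)) (Real.pi / 2) c - Real.tan (-(Γ - D)) * Real.log c
    spiralPot (-(Γ - D)) k c = legPot (Real.pi - (Γ + D)) (Real.pi / 2) c ∧
      spiralAngle (-(Γ - D)) k c = legAngle (Real.pi - (Γ + D)) (Real.pi / 2) c := by
  intro k
  have hpi := Real.pi_pos
  have h2 : spiralAngle (-(Γ - D)) k c = legAngle (Real.pi - (Γ + D)) (Real.pi / 2) c := by
    unfold spiralAngle; simp only [k]; ring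
  refine ⟨?_, h2⟩
  have h3 := spiral_radial (-(Γ - D)) k c
  have hcA : c ≤ Real.sin (Real.pi - (Γ + D)) := by rwa [Real.sin_pi_sub]
  have h4 : legPot (Real.pi - (Γ + D)) (Real.pi / 2) c -
      c * legAngle (Real.pi - (Γ + D)) (Real.pi / 2) c =
      1 / Real.cos (Real.pi - (Γ + D)) - c * Real.tan (Real.pi - (Γ + D)) := by
    simp only [legPot, legAngle, glue, if_pos hcA]
    exact spiral_radial _ _ _
  have h5 : 1 / Real.cos (-(Γ - D)) - c * Real.tan (-(Γ - D)) =
      1 / Real.cos (Real.pi - (Γ + D)) - c * Real.tan (Real.pi - (Γ + D)) := by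
    have hc1 : 0 < Real.cos (Γ - D) := Real.cos_pos_of_mem_Ioo ⟨by linarith, by linarith⟩
    have hc2 : Real.cos (Γ + D) < 0 := Real.cos_neg_of_pi_div_two_lt_of_lt hφ₂ (by linarith)
    rw [Real.cos_neg, Real.tan_neg, Real.cos_pi_sub, Real.tan_pi_sub, Real.tan_eq_sin_div_cos,
      Real.tan_eq_sin_div_cos]
    have key : Real.cos (Γ - D) + Real.cos (Γ + D) =
        c * (Real.sin (Γ + D) * Real.cos (Γ - D) - Real.cos (Γ + D) * Real.sin (Γ - D)) := by
      rw [← Real.sin_sub, show Γ + D - (Γ - D) = 2 * D by ring, Real.sin_two_mul,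
        Real.cos_add, Real.cos_sub, ← hc]
      ring
    have := hc2.ne
    field_simp
    linear_combination key
  rw [h2] at h3
  linarith

/-- Lateral motion is permitted, so inward bearings are clipped at `π / 2` and the closest approach
is at `s = 1`. Outward motion is forward near the feature (a leg after a half turn) and backward at
bearing `φ₁` for `s ≤ c`. Both radial coefficients vanish at `s = 1`, hence no gap. -/
theorem isExtremalPair_lateral {ε Γ D : ℝ} (hε : 0 < ε) (hD : 0 < D) (hD' : D ≤ Real.pi / 4)
    (hΓ : 0 ≤ Γ) (hΓ' : Γ ≤ Real.pi / 2) (hφ₂ : Real.pi / 2 < Γ + D) :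
    IsExtremalPair ε (Γ - D) (Γ + D) 1
      (legPot (Γ - D) (Real.pi / 2)) (legAngle (Γ - D) (Real.pi / 2))
      (lateralPot (Real.cos Γ / Real.sin D) (Γ - D) (Γ + D))
      (lateralAngle (Real.cos Γ / Real.sin D) (Γ - D) (Γ + D)) := by
  have hpi := Real.pi_pos
  have hcosΓ : 0 ≤ Real.cos Γ := Real.cos_nonneg_of_mem_Icc ⟨by linarith, by linarith⟩
  have hsinD : 0 < Real.sin D := Real.sin_pos_of_pos_of_lt_pi hD (by linarith)
  have hφ₁ : 0 < Γ - D := by linarith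
  have hφ₁' : Γ - D < Real.pi / 2 := by linarith
  set c := Real.cos Γ / Real.sin D with hcdef
  have hc : c * Real.sin D = Real.cos Γ := by rw [hcdef]; field_simp
  have hc0 : 0 ≤ c := by positivity
  have hcosφ₂ : Real.cos (Γ + D) < 0 := Real.cos_neg_of_pi_div_two_lt_of_lt hφ₂ (by linarith)
  have hcφ : c ≤ Real.sin (Γ + D) := by
    refine le_of_mul_le_mul_right ?_ hsinD
    have e : Real.cos Γ = Real.cos (Γ + D) * Real.cos D + Real.sin (Γ + D) * Real.sin D := by
      rw [← Real.cos_sub]; congr 1; ring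
    have : 0 ≤ Real.cos D := Real.cos_nonneg_of_mem_Icc ⟨by linarith, by linarith⟩
    rw [hc, e]
    nlinarith
  have hc1 : c < 1 := by
    refine hcφ.trans_lt ?_
    have := Real.sin_sq_add_cos_sq (Γ + D)
    nlinarith [Real.sin_le_one (Γ + D), Real.neg_one_le_sin (Γ + D), mul_pos_of_neg_of_neg hcosφ₂ hcosφ₂]
  have hcosA : 0 < Real.cos (-(Γ - D)) := Real.cos_pos_of_mem_Ioo ⟨by linarith, by linarith⟩
  have hm := lateral_match hD hD' hΓ' hφ₁ hφ₂ hc hcφ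
  have hend : ∀ s ≤ (1 : ℝ), s ≤ Real.sin (Real.pi / 2) ∨ Real.pi / 2 < Real.pi / 2 :=
    fun s hs => by left; rwa [Real.sin_pi_div_two]
  have hone : lateralPot c (Γ - D) (Γ + D) 1 - 1 * lateralAngle c (Γ - D) (Γ + D) 1 = 0 := by
    rw [lateralPot, lateralAngle, glue, glue, if_neg hc1.not_ge, if_neg hc1.not_ge]
    exact leg_radial_one (by linarith) (by linarith)
  have hone' := leg_radial_one hφ₁ hφ₁'
  refine ⟨one_pos, ⟨fun s hs => hasDerivAt_legPot (by linarith) hφ₁' le_rfl hs,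
    fun s hs hs1 b hb hb' => lateral_inward_bound hφ₁ hφ₁' (by linarith) hs hs1 hb hb'⟩,
    ⟨fun s hs => ?_, fun s hs hs1 b hb hb' => ?_⟩, fun s₀ s₁ h0 h01 h1 => isLeg_leg hε
      (by linarith) hφ₁' le_rfl le_rfl hφ₂.le h0 h01 (hend s₁ h1), fun s₀ s₁ h0 h01 h1 => ?_,
    by rw [hone, hone', add_zero], Or.inl (by rw [hone, hone', add_zero]), ?_⟩
  · exact hasDerivAt_glue (hasDerivAt_spiralPot _ _ hs)
      (hasDerivAt_legPot (by linarith) (by linarith) le_rfl hs) fun _ => hm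
  · rcases le_or_gt s c with h | h
    · rw [lateralPot, lateralAngle, glue, glue, if_pos h, if_pos h, spiral_radial]
      exact lateral_backward_bound hD hD' hΓ hΓ' hφ₁ hc h hs hb hb'
    · rw [lateralPot, lateralAngle, glue, glue, if_neg h.not_ge, if_neg h.not_ge]
      have := lateral_outward_bound (b := -b) hD hD' hΓ' hφ₂ hc h.le hs hs1 (by linarith)
        (by linarith)
      rwa [Real.cos_neg, Real.sin_neg, mul_neg, sub_neg_eq_add] at this
  · refine IsLeg.glue hε h01 (fun h => isLeg_spiral hε ⟨by linarith, le_rfl⟩ hcosA _ h0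
      (le_min h01 h)) (fun h => IsLeg.halfTurn_symm (isLeg_leg hε (by linarith) (by linarith)
        le_rfl (by linarith) (by linarith) (lt_max_of_lt_left h0) (max_le h01 h.le)
        (hend s₁ h1))) fun _ _ => hm
  · rw [max_eq_left hφ₁.le]
    have h1 := tendsto_legPot_of_pos (B := Real.pi / 2) hφ₁ (by linarith)
    have h2 : Filter.Tendsto (lateralPot c (Γ - D) (Γ + D)) (nhdsWithin 0 (Ioi 0))
        (nhds (1 / Real.cos (Γ - D))) := by
      rcases eq_or_lt_of_le hc0 with h | h
      -- For `c = 0` the backward spiral disappears; the cone is then symmetric about `π / 2`, so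
      -- the other spiral has the same limit.
      · have hΓ2 : Real.cos Γ = 0 := by rw [← hc, ← h, zero_mul]
        have : Γ = Real.pi / 2 := by
          by_contra hne
          have := Real.cos_pos_of_mem_Ioo (x := Γ) ⟨by linarith, lt_of_le_of_ne hΓ' hne⟩
          linarith
        have e : Real.pi - (Γ + D) = Γ - D := by linarith
        have := tendsto_legPot_of_pos (A := Real.pi - (Γ + D)) (B := Real.pi / 2) (by linarith)
          (by linarith)
        rw [e] at this
        rw [lateralPot, e]
        exact tendsto_glue_of_nonpos h.symm.le this
      · have := tendsto_glue_of_pos (g := legPot (Real.pi - (Γ + D)) (Real.pi / 2)) h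
          (tendsto_spiralPot (-(Γ - D)) (legAngle (Real.pi - (Γ + D)) (Real.pi / 2) c -
            Real.tan (-(Γ - D)) * Real.log c))
        rwa [Real.cos_neg] at this
    convert h1.add h2 using 2
    ring

/-! ### From motions to feasible paths -/

theorem continuous_statePoint : Continuous statePoint := by
  unfold statePoint polarPoint
  fun_prop

section feasible

variable {U : Set (ℝ × ℝ)} {ε φ₁ φ₂ : ℝ}

theorem IsDriven.const (hε : 0 ≤ ε) {X : ℝ × ℝ × ℝ} (hX : 0 < X.1) (hX' : X.2.2 ∈ Icc φ₁ φ₂) :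
    IsDriven ε φ₁ φ₂ 1 (fun _ => X) (fun _ => 0) (fun _ => 0) := by
  refine ⟨zero_le_one, measurable_const, measurable_const, fun _ _ => by simpa, fun _ _ => by simpa,
    ⟨0, (LipschitzWith.const X).lipschitzOnWith⟩, fun _ _ => hX, fun _ _ => hX', ∅,
    countable_empty, fun t _ _ => (hasDerivAt_const t X).congr_deriv ?_⟩
  simp only [unicycleField, mul_zero, sub_zero]
  rfl

theorem IsDriven.exists_isFeasiblePath (hU : ∀ a b : ℝ, |a| ≤ ε → |b| ≤ ε → (a, b) ∈ U) {T ℓ : ℝ}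
    {x : ℝ → ℝ × ℝ × ℝ} {ν ω : ℝ → ℝ} (h : IsDriven ε φ₁ φ₂ T x ν ω) (hT : 0 < T)
    (hv : eVariationOn (fun t => statePoint (x t)) (Icc 0 T) ≤ ENNReal.ofReal ℓ) :
    ∃ γ, IsFeasiblePath U φ₁ φ₂ (statePoint (x 0)) (statePoint (x T)) γ ∧
      pathLength γ ≤ ENNReal.ofReal ℓ := by
  obtain ⟨K, hK⟩ := h.lipschitz
  have hmaps : MapsTo (fun s => s * T) (Icc (0 : ℝ) 1) (Icc 0 T) := fun s hs =>
    ⟨mul_nonneg hs.1 hT.le, mul_le_of_le_one_left hT.le hs.2⟩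
  refine ⟨fun s => statePoint (x (s * T)), ⟨?_, by simp, by simp, fun a b ha hab hb _ => ?_⟩, ?_⟩
  · exact continuous_statePoint.comp_continuousOn
      (hK.continuousOn.comp (by fun_prop) hmaps)
  · have haT := mul_le_mul_of_nonneg_right hab hT.le
    have hr := h.restrict (mul_nonneg ha hT.le) haT (mul_le_of_le_one_left hT.le hb)
    refine ⟨_, _, _, _, _, _, fun t => a + t / T, hr.isFeasibleMotion hU, by fun_prop,
      fun s _ t _ hst => ?_, by simp, by field_simp; ring, fun t _ => ?_⟩
    · have := div_le_div_of_nonneg_right hst hT.le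
      linarith
    · have : (a + t / T) * T = a * T + t := by field_simp
      simp only [this]; rfl
  · refine le_trans ?_ hv
    exact eVariationOn.comp_le_of_monotoneOn (fun t => statePoint (x t)) (fun s => s * T)
      (fun s _ t _ hst => mul_le_mul_of_nonneg_right hst hT.le) hmaps

theorem Reach.exists_isFeasiblePath (hε : 0 ≤ ε)
    (hU : ∀ a b : ℝ, |a| ≤ ε → |b| ≤ ε → (a, b) ∈ U) {ρ₀ ψ₀ ρ₁ ψ₁ ℓ : ℝ}
    (h : Reach ε φ₁ φ₂ ρ₀ ψ₀ ρ₁ ψ₁ ℓ) :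
    ∃ γ, IsFeasiblePath U φ₁ φ₂ (polarPoint ρ₀ ψ₀) (polarPoint ρ₁ ψ₁) γ ∧
      pathLength γ ≤ ENNReal.ofReal ℓ := by
  obtain ⟨β₀, β₁, h⟩ := h
  have hmem := h.mem_cone
  obtain ⟨hℓ, T, x, ν, ω, hx, h0, hT, hv⟩ := h
  rcases eq_or_lt_of_le hx.nonneg with hT0 | hT0
  · rw [← hT0, h0] at hT
    -- A motion of zero duration cannot be rescaled to `[0, 1]`; it is replaced by resting for one
    -- unit of time.
    have := (IsDriven.const hε hmem.1 hmem.2.1).exists_isFeasiblePath hU (ℓ := ℓ) one_pos (by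
      rw [eVariationOn.constant_on]
      · exact zero_le
      · exact fun a ha b hb => by
          obtain ⟨_, _, rfl⟩ := ha
          obtain ⟨_, _, rfl⟩ := hb
          rfl)
    obtain ⟨γ, hγ, hγ'⟩ := this
    refine ⟨γ, ?_, hγ'⟩
    nth_rewrite 2 [hT] at hγ
    exact hγ
  · obtain ⟨γ, hγ, hγ'⟩ := hx.exists_isFeasiblePath hU hT0 hv
    rw [h0, hT] at hγ
    exact ⟨γ, hγ, hγ'⟩

theorem isExecutable_of_curve (hε : 0 < ε) (hU : ∀ a b : ℝ, |a| ≤ ε → |b| ≤ ε → (a, b) ∈ U)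
    {a b : ℝ} (hab : a ≤ b) {x : ℝ → ℝ × ℝ × ℝ} {ν ω : ℝ → ℝ} (hν : Measurable ν)
    (hω : Measurable ω) (hνc : ContinuousOn ν (Icc a b)) (hωc : ContinuousOn ω (Icc a b))
    (hpos : ∀ t ∈ Icc a b, 0 < (x t).1) (hcone : ∀ t ∈ Icc a b, (x t).2.2 ∈ Icc φ₁ φ₂)
    (hd : ∀ t ∈ Icc a b, HasDerivAt x (unicycleField (x t) (ν t) (ω t)) t) {γ : ℝ → ℂ}
    (hγ : ∀ t ∈ Icc a b, statePoint (x t) = γ t) : IsExecutable U φ₁ φ₂ γ a b := by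
  obtain ⟨c, hc, h⟩ := exists_isDriven hε hab hν hω hνc hωc hpos hcone hd
  refine ⟨_, _, _, _, _, _, fun t => a + c * t, h.isFeasibleMotion hU, by fun_prop,
    fun s _ t _ hst => ?_, by simp, by field_simp; ring, fun t ht => hγ _ ?_⟩
  · have := mul_le_mul_of_nonneg_left hst hc.le
    linarith
  · have h1 := mul_nonneg hc.le ht.1
    have h2 := (le_div_iff₀ hc).1 ht.2
    exact ⟨by linarith, by linarith⟩

/-- The states of a vehicle on the logarithmic spiral through the feature at time `1 / 2`; the sign
`κ` is `1` before and `-1` after. -/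
noncomputable def spiralState (R θ φ κ s : ℝ) : ℝ × ℝ × ℝ :=
  (R * (κ * (1 - 2 * s)), θ - Real.tan φ * Real.log (1 - 2 * s), φ)

/-- Since `Real.log` is even, the same formula for the angle serves on both sides of `1 / 2`; after
it the vehicle drives backwards. -/
theorem hasDerivAt_spiralState {R θ φ κ s : ℝ} (hR : 0 < R) (hκ : κ ≠ 0) (hs : 1 - 2 * s ≠ 0)
    (hφ : Real.cos φ ≠ 0) :
    HasDerivAt (spiralState R θ φ κ) (unicycleField (spiralState R θ φ κ s)
      (κ * (2 * R / Real.cos φ)) (2 * Real.tan φ / (1 - 2 * s))) s := by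
  have h1 : HasDerivAt (fun s : ℝ => 1 - 2 * s) (-2) s := by
    simpa using ((hasDerivAt_id s).const_mul 2).const_sub 1
  have h2 := (h1.const_mul κ).const_mul R
  have h3 := ((h1.log hs).const_mul (Real.tan φ)).const_sub θ
  refine (h2.prodMk (h3.prodMk (hasDerivAt_const s φ))).congr_deriv ?_
  simp only [unicycleField, spiralState, Real.tan_eq_sin_div_cos]
  refine Prod.ext ?_ (Prod.ext ?_ ?_) <;> simp only <;> field_simp
  ring

/-- The path that runs along a logarithmic spiral into the feature and leaves it along another. -/
noncomputable def spiralPath (R θ φ s : ℝ) : ℂ :=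
  if s < 1 / 2 then statePoint (spiralState R θ φ 1 s)
  else statePoint (spiralState R 0 φ (-1) s)

theorem norm_spiralPath {R θ φ s : ℝ} (hR : 0 < R) : ‖spiralPath R θ φ s‖ = R * |1 - 2 * s| := by
  unfold spiralPath statePoint spiralState
  split_ifs <;> simp only [norm_polarPoint, abs_mul, abs_of_pos hR, abs_neg, abs_one, one_mul]

theorem dist_spiralPath_le {R θ φ : ℝ} (hR : 0 < R) (hφ : 0 < Real.cos φ) {s t : ℝ}
    (hst : s ≤ t) :
    dist (spiralPath R θ φ s) (spiralPath R θ φ t) ≤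
      2 * R / Real.cos φ * t - 2 * R / Real.cos φ * s := by
  have hK : 2 * R ≤ 2 * R / Real.cos φ := by
    rw [le_div_iff₀ hφ]; nlinarith [Real.cos_le_one φ]
  have hKpos : 0 < 2 * R / Real.cos φ := by positivity
  have hl : ∀ κ : ℝ, |κ| = 1 → ∀ u, HasDerivAt (fun u => 2 * R / Real.cos φ * u)
      |κ * (2 * R / Real.cos φ)| u := fun κ hκ u => by
    rw [abs_mul, hκ, abs_of_pos hKpos]
    simpa using (hasDerivAt_id u).const_mul (2 * R / Real.cos φ)
  have key : ∀ κ θ', |κ| = 1 → (∀ u ∈ Icc s t, 0 < κ * (1 - 2 * u)) →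
      dist (statePoint (spiralState R θ' φ κ s)) (statePoint (spiralState R θ' φ κ t)) ≤
        2 * R / Real.cos φ * t - 2 * R / Real.cos φ * s := fun κ θ' hκ hu =>
    dist_statePoint_le (a := s) (b := t) (x := spiralState R θ' φ κ)
      (ν := fun _ => κ * (2 * R / Real.cos φ)) (ω := fun s => 2 * Real.tan φ / (1 - 2 * s))
      (fun u h => mul_pos hR (hu u h)) (fun u h => hasDerivAt_spiralState hR
        (left_ne_zero_of_mul (hu u h).ne') (right_ne_zero_of_mul (hu u h).ne') hφ.ne')
      (fun u _ => hl κ hκ u) s (left_mem_Icc.2 hst) t (right_mem_Icc.2 hst) hst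
  rcases lt_or_ge t (1 / 2) with ht | ht
  · rw [spiralPath, spiralPath, if_pos ht, if_pos (hst.trans_lt ht)]
    exact key 1 θ (by simp) fun u hu => by linarith [hu.2]
  · rcases lt_or_ge (1 / 2) s with hs | hs
    · rw [spiralPath, spiralPath, if_neg ht.not_gt, if_neg hs.le.not_gt]
      exact key (-1) 0 (by simp) fun u hu => by linarith [hu.1]
    -- When `1 / 2` lies between the parameters, the triangle inequality through the feature
    -- suffices.
    · refine (dist_le_norm_add_norm _ _).trans ?_
      rw [norm_spiralPath hR, norm_spiralPath hR, abs_of_nonneg (by linarith : 0 ≤ 1 - 2 * s),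
        abs_of_nonpos (by linarith : 1 - 2 * t ≤ 0)]
      nlinarith

theorem isFeasiblePath_spiralPath (hε : 0 < ε)
    (hU : ∀ a b : ℝ, |a| ≤ ε → |b| ≤ ε → (a, b) ∈ U) {R θ φ : ℝ} (hR : 0 < R)
    (hφ : 0 < Real.cos φ) (hφ' : φ ∈ Icc φ₁ φ₂) :
    IsFeasiblePath U φ₁ φ₂ (polarPoint R θ) (polarPoint R 0) (spiralPath R θ φ) := by
  refine ⟨?_, ?_, ?_, fun a b _ hab _ hne => ?_⟩
  · have hKpos : 0 < 2 * R / Real.cos φ := by positivity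
    have : LipschitzWith (Real.toNNReal (2 * R / Real.cos φ)) (spiralPath R θ φ) := by
      refine LipschitzWith.of_dist_le_mul fun s t => ?_
      rw [Real.coe_toNNReal _ hKpos.le, Real.dist_eq]
      rcases le_total s t with h | h
      · rw [abs_of_nonpos (by linarith)]
        linarith [dist_spiralPath_le (θ := θ) hR hφ h]
      · rw [abs_of_nonneg (by linarith), dist_comm]
        linarith [dist_spiralPath_le (θ := θ) hR hφ h]
    exact this.continuous.continuousOn
  · norm_num [spiralPath, spiralState, statePoint]
  · norm_num [spiralPath, spiralState, statePoint]
  · have hhalf : spiralPath R θ φ (1 / 2) = 0 := by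
      rw [← norm_eq_zero, norm_spiralPath hR]; norm_num
    have key : ∀ κ θ', (∀ u ∈ Icc a b, 0 < κ * (1 - 2 * u)) →
        (∀ u ∈ Icc a b, statePoint (spiralState R θ' φ κ u) = spiralPath R θ φ u) →
        IsExecutable U φ₁ φ₂ (spiralPath R θ φ) a b := fun κ θ' hu hγ =>
      isExecutable_of_curve hε hU hab (x := spiralState R θ' φ κ)
        (ν := fun _ => κ * (2 * R / Real.cos φ)) (ω := fun s => 2 * Real.tan φ / (1 - 2 * s))
        measurable_const (by fun_prop) continuousOn_const
        (continuousOn_const.div (by fun_prop) fun u h => right_ne_zero_of_mul (hu u h).ne')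
        (fun u h => mul_pos hR (hu u h)) (fun _ _ => hφ') (fun u h => hasDerivAt_spiralState hR
          (left_ne_zero_of_mul (hu u h).ne') (right_ne_zero_of_mul (hu u h).ne') hφ.ne') hγ
    rcases lt_or_ge b (1 / 2) with hb | hb
    · refine key 1 θ (fun u hu => by linarith [hu.2]) fun u hu => ?_
      rw [spiralPath, if_pos (hu.2.trans_lt hb)]
    · have ha : 1 / 2 < a := by
        by_contra h
        exact hne (1 / 2) ⟨not_lt.1 h, hb⟩ hhalf
      refine key (-1) 0 (fun u hu => by linarith [hu.1]) fun u hu => ?_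
      rw [spiralPath, if_neg (ha.trans_le hu.1).not_gt]

theorem pathLength_spiralPath_le {R θ φ : ℝ} (hR : 0 < R) (hφ : 0 < Real.cos φ) :
    pathLength (spiralPath R θ φ) ≤ ENNReal.ofReal (2 * R / Real.cos φ) := by
  have := eVariationOn_le_of_dist_le (z := spiralPath R θ φ)
    (l := fun s => 2 * R / Real.cos φ * s) zero_le_one
    fun s _ t _ hst => dist_spiralPath_le hR hφ hst
  simpa [pathLength] using this

end feasible

/-! ### Minimizing the dual length -/

section extremal

variable {ε φ₁ φ₂ S : ℝ} {Φ T Φ' T' : ℝ → ℝ}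

/-- Normalized length bound for the momentum quotient `p` and the angular displacement `d`. -/
noncomputable def dualLength (S : ℝ) (Φ Φ' : ℝ → ℝ) (d p : ℝ) : ℝ :=
  p * d + (Φ p + Φ' p) - p * ((Φ S + Φ' S) / S)

theorem IsExtremalPair.reach_circle (h : IsExtremalPair ε φ₁ φ₂ S Φ T Φ' T') (hε : 0 < ε)
    (hφ : φ₁ ≤ φ₂) {R : ℝ} (hR : 0 < R) (ψ : ℝ) :
    let w := (Φ S - S * T S) + (Φ' S - S * T' S)
    Reach ε φ₁ φ₂ (R / S) ψ (R / S) (ψ + w / S) (R * (w / S)) := by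
  intro w
  rcases h.gap with hw | ⟨hlat, hS⟩
  · have hw' : w = 0 := hw
    rw [hw', zero_div, mul_zero, add_zero]
    exact Reach.refl hε hφ (div_pos hR h.pos)
  · have hw : 0 ≤ w := h.gap_nonneg
    rw [hS, div_one, div_one]
    exact Reach.circle hε hlat hR hw ψ

/-- The critical-point equation for `p` is the closing condition for the angles: inward leg,
possible circular arc and outward leg together turn by `d`. The outward leg is a mirrored inward leg
run in reverse. -/
theorem IsExtremalPair.reach (h : IsExtremalPair ε φ₁ φ₂ S Φ T Φ' T') (hε : 0 < ε)
    (hφ : φ₁ ≤ φ₂) {R p d : ℝ} (hR : 0 < R) (hp : 0 < p) (hpS : p ≤ S)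
    (hd : d + (T p + T' p) - (Φ S + Φ' S) / S = 0) (ψ : ℝ) :
    Reach ε φ₁ φ₂ R ψ R (ψ + d) (R * dualLength S Φ Φ' d p) := by
  have hS := h.pos
  have hP : 0 < R * p := by positivity
  have e0 : R * p / p = R := by field_simp
  have i1 := h.leg_inward p S hp hpS le_rfl (R * p) hP ψ
  have i2 := h.reach_circle hε hφ hP (ψ + (T S - T p))
  have i3 := (h.leg_outward p S hp hpS le_rfl (R * p) hP (-(ψ + d))).mirror.symm
  rw [neg_neg, neg_neg] at i3
  rw [e0] at i1 i3
  have e1 : -(-(ψ + d) + (T' S - T' p)) =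
      ψ + (T S - T p) + ((Φ S - S * T S) + (Φ' S - S * T' S)) / S := by
    have : ((Φ S - S * T S) + (Φ' S - S * T' S)) / S = (Φ S + Φ' S) / S - (T S + T' S) := by
      field_simp; ring
    rw [this]
    linear_combination hd
  rw [e1, neg_neg] at i3
  convert (i1.trans hε i2).trans hε i3 using 1
  have hd' : d = (Φ S + Φ' S) / S - (T p + T' p) := by linarith
  rw [dualLength, hd']
  field_simp
  ring

theorem IsExtremalPair.exists_isMinOn (h : IsExtremalPair ε φ₁ φ₂ S Φ T Φ' T') (d : ℝ) :
    (∀ p, 0 < p → p ≤ S → 2 / Real.cos (max φ₁ 0) ≤ dualLength S Φ Φ' d p) ∨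
    ∃ p, 0 < p ∧ p ≤ S ∧ dualLength S Φ Φ' d p ≤ 2 / Real.cos (max φ₁ 0) ∧
      ∀ q, 0 < q → q ≤ S → dualLength S Φ Φ' d p ≤ dualLength S Φ Φ' d q := by
  have hS := h.pos
  -- The continuous extension to `p = 0` has as its value there the normalized length of the path
  -- through the feature, so compactness decides between the two alternatives.
  set J : ℝ → ℝ := fun p => if p ≤ 0 then 2 / Real.cos (max φ₁ 0) else dualLength S Φ Φ' d p
    with hJ
  have hJ0 : J 0 = 2 / Real.cos (max φ₁ 0) := if_pos le_rfl
  have hJp : ∀ p, 0 < p → J p = dualLength S Φ Φ' d p := fun p hp => if_neg hp.not_ge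
  have hcont : ContinuousOn J (Icc 0 S) := by
    intro p hp
    rcases eq_or_lt_of_le hp.1 with rfl | hp0
    · have hlim : Filter.Tendsto (dualLength S Φ Φ' d) (nhdsWithin 0 (Ioi 0))
          (nhds (2 / Real.cos (max φ₁ 0))) := by
        have hid : Filter.Tendsto (fun p : ℝ => p) (nhdsWithin 0 (Ioi 0)) (nhds 0) :=
          nhdsWithin_le_nhds
        have := ((hid.mul_const d).add h.limit).sub (hid.mul_const ((Φ S + Φ' S) / S))
        simp only [zero_mul, zero_add, sub_zero] at this
        exact this
      have : ContinuousWithinAt J (Ioi 0) 0 := by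
        rw [ContinuousWithinAt, hJ0]
        refine hlim.congr' ?_
        filter_upwards [self_mem_nhdsWithin] with q hq
        exact (hJp q hq).symm
      exact (continuousWithinAt_Ioi_iff_Ici.1 this).mono fun q hq => hq.1
    · have : ContinuousAt J p := by
        have h1 := (h.inward.deriv p hp0).continuousAt
        have h2 := (h.outward.deriv p hp0).continuousAt
        have h3 : ContinuousAt (dualLength S Φ Φ' d) p := by
          unfold dualLength
          fun_prop
        refine h3.congr ?_
        filter_upwards [Ioi_mem_nhds hp0] with q hq
        exact (hJp q hq).symm
      exact this.continuousWithinAt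
  obtain ⟨p, hp, hmin⟩ := isCompact_Icc.exists_isMinOn (nonempty_Icc.2 hS.le) hcont
  rw [isMinOn_iff] at hmin
  rcases eq_or_lt_of_le hp.1 with hp0 | hp0
  · left
    intro q hq hqS
    have := hmin q ⟨hq.le, hqS⟩
    rwa [← hp0, hJ0, hJp q hq] at this
  · right
    refine ⟨p, hp0, hp.2, ?_, fun q hq hqS => ?_⟩
    · rw [← hJ0, ← hJp p hp0]
      exact hmin 0 ⟨le_rfl, hS.le⟩
    · rw [← hJp p hp0, ← hJp q hq]
      exact hmin q ⟨hq.le, hqS⟩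

theorem IsExtremalPair.hasDerivAt_dualLength (h : IsExtremalPair ε φ₁ φ₂ S Φ T Φ' T') (d : ℝ)
    {p : ℝ} (hp : 0 < p) :
    HasDerivAt (dualLength S Φ Φ' d) (d + (T p + T' p) - (Φ S + Φ' S) / S) p := by
  have hd1 : ∀ c : ℝ, HasDerivAt (fun p : ℝ => p * c) c p := fun c => by
    simpa using (hasDerivAt_id p).mul_const c
  exact ((hd1 d).add ((h.inward.deriv p hp).add (h.outward.deriv p hp))).sub (hd1 _)

/-- A minimizer of the dual length is realized by a motion. -/
theorem IsExtremalPair.reach_of_isMin (h : IsExtremalPair ε φ₁ φ₂ S Φ T Φ' T') (hε : 0 < ε)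
    (hφ : φ₁ ≤ φ₂) {R p d : ℝ} (hR : 0 < R) (hd : 0 < d) (hp : 0 < p) (hpS : p ≤ S)
    (hmin : ∀ q, 0 < q → q ≤ S → dualLength S Φ Φ' d p ≤ dualLength S Φ Φ' d q) (ψ : ℝ) :
    Reach ε φ₁ φ₂ R ψ R (ψ + d) (R * dualLength S Φ Φ' d p) := by
  have hS := h.pos
  have hderiv := h.hasDerivAt_dualLength d hp
  rcases eq_or_lt_of_le hpS with rfl | hlt
  · rcases h.gap with hw | ⟨hlat, hS1⟩
    -- Without a gap the derivative at `p = S` equals `d > 0`, so smaller values of `p` would do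
    -- better.
    · exfalso
      have e : d + (T p + T' p) - (Φ p + Φ' p) / p = d := by
        have : (Φ p + Φ' p) / p = T p + T' p := by
          rw [div_eq_iff hp.ne']; linarith
        rw [this]; ring
      rw [e] at hderiv
      have hslope := (hasDerivWithinAt_iff_tendsto_slope' (s := Iio p) (by simp)).1
        (hderiv.hasDerivWithinAt (s := Iio p))
      refine absurd (le_of_tendsto hslope ?_ : d ≤ 0) (not_le.2 hd)
      filter_upwards [Ioo_mem_nhdsLT hp] with q hq
      rw [slope_def_field]
      exact div_nonpos_of_nonneg_of_nonpos (sub_nonneg.2 (hmin q hq.1 hq.2.le))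
        (sub_nonpos.2 hq.2.le)
    · have e : dualLength p Φ Φ' d p = d := by rw [dualLength, hS1]; ring
      rw [e]
      exact Reach.circle hε hlat hR hd.le ψ
  · have hloc : IsLocalMin (dualLength S Φ Φ' d) p := by
      filter_upwards [Ioo_mem_nhds hp hlt] with q hq
      exact hmin q hq.1 hq.2.le
    exact h.reach hε hφ hR hp hpS (hloc.hasDerivAt_eq_zero hderiv) ψ

theorem exists_shortest_of_isExtremalPair (h : IsExtremalPair ε φ₁ φ₂ S Φ T Φ' T') (hε : 0 < ε)
    {U : Set (ℝ × ℝ)} (hU : ∀ a b : ℝ, |a| ≤ ε → |b| ≤ ε → (a, b) ∈ U)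
    (hφ : φ₁ ≤ φ₂) (hφ₂ : 0 ≤ φ₂) (hcos₁ : 0 < Real.cos φ₁) (hcos : 0 < Real.cos (max φ₁ 0))
    (hcos' : ∀ b, φ₁ ≤ b → b ≤ φ₂ → |Real.cos b| ≤ Real.cos (max φ₁ 0))
    {R θ : ℝ} (hR : 0 < R) (hθ : |θ| ≤ Real.pi) :
    ∃ γ, IsFeasiblePath U φ₁ φ₂ (polarPoint R θ) (polarPoint R 0) γ ∧ pathLength γ < ⊤ ∧
      ∀ γ', IsFeasiblePath U φ₁ φ₂ (polarPoint R θ) (polarPoint R 0) γ' →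
        pathLength γ ≤ pathLength γ' := by
  rcases eq_or_ne θ 0 with rfl | hθ0
  · obtain ⟨γ, hγ, hγ'⟩ := (Reach.refl (ψ₀ := 0) hε hφ hR).exists_isFeasiblePath hε.le hU
    exact ⟨γ, hγ, hγ'.trans_lt ENNReal.ofReal_lt_top, fun _ _ => hγ'.trans (by simp)⟩
  have hd : 0 < |θ| := abs_pos.2 hθ0
  have lower : ∀ γ', IsFeasiblePath U φ₁ φ₂ (polarPoint R θ) (polarPoint R 0) γ' →
      ENNReal.ofReal (2 * R / Real.cos (max φ₁ 0)) ≤ pathLength γ' ∨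
      ∃ p, 0 < p ∧ p ≤ S ∧
        ENNReal.ofReal (R * dualLength S Φ Φ' |θ| p) ≤ pathLength γ' := by
    intro γ' hγ'
    by_cases hz : ∃ s ∈ Icc (0 : ℝ) 1, γ' s = 0
    · exact Or.inl (hγ'.ofReal_le_of_eq_zero hcos hR hcos'
        (by rw [norm_polarPoint, abs_of_pos hR]) (by rw [norm_polarPoint, abs_of_pos hR]) hz)
    · push Not at hz
      exact Or.inr (hγ'.exists_ofReal_le hR hθ h.pos h.inward h.outward hφ hcos₁ hz)
  have e : R * (2 / Real.cos (max φ₁ 0)) = 2 * R / Real.cos (max φ₁ 0) := by ring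
  rcases h.exists_isMinOn |θ| with hmin | ⟨p, hp, hpS, hp0, hmin⟩
  · refine ⟨_, isFeasiblePath_spiralPath hε hU hR hcos ⟨le_max_left _ _, max_le hφ hφ₂⟩,
      (pathLength_spiralPath_le hR hcos).trans_lt ENNReal.ofReal_lt_top, fun γ' hγ' =>
      (pathLength_spiralPath_le hR hcos).trans ?_⟩
    rcases lower γ' hγ' with hl | ⟨q, hq, hqS, hl⟩
    · exact hl
    · refine le_trans (ENNReal.ofReal_le_ofReal ?_) hl
      rw [← e]
      exact mul_le_mul_of_nonneg_left (hmin q hq hqS) hR.le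
  · have hreach : Reach ε φ₁ φ₂ R θ R 0 (R * dualLength S Φ Φ' |θ| p) := by
      -- The constructed motions increase the polar angle; for `θ ≥ 0` the path from angle `0` to
      -- `θ` is run in reverse.
      rcases le_total θ 0 with hs | hs
      · have := h.reach_of_isMin hε hφ hR hd hp hpS hmin θ
        rwa [show θ + |θ| = 0 by rw [abs_of_nonpos hs]; ring] at this
      · have := h.reach_of_isMin hε hφ hR hd hp hpS hmin 0
        rw [show 0 + |θ| = θ by rw [abs_of_nonneg hs]; ring] at this
        exact this.symm
    obtain ⟨γ, hγ, hγ'⟩ := hreach.exists_isFeasiblePath hε.le hU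
    refine ⟨γ, hγ, hγ'.trans_lt ENNReal.ofReal_lt_top, fun γ' hg => hγ'.trans ?_⟩
    rcases lower γ' hg with hl | ⟨q, hq, hqS, hl⟩
    · refine le_trans (ENNReal.ofReal_le_ofReal ?_) hl
      rw [← e]
      exact mul_le_mul_of_nonneg_left hp0 hR.le
    · exact (ENNReal.ofReal_le_ofReal (mul_le_mul_of_nonneg_left (hmin q hq hqS) hR.le)).trans hl

end extremal

/-! ### Conclusion -/

theorem exists_box_subset {U : Set (ℝ × ℝ)} (h : (0 : ℝ × ℝ) ∈ interior U) :
    ∃ ε, 0 < ε ∧ ∀ a b : ℝ, |a| ≤ ε → |b| ≤ ε → (a, b) ∈ U := by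
  obtain ⟨r, hr, hU⟩ := Metric.mem_nhds_iff.1 (mem_interior_iff_mem_nhds.1 h)
  refine ⟨r / 2, half_pos hr, fun a b ha hb => hU ?_⟩
  rw [mem_ball_zero_iff, Prod.norm_def]
  exact max_lt (by rw [Real.norm_eq_abs]; linarith) (by rw [Real.norm_eq_abs]; linarith)

theorem mainTheorem7 (Γ δ ρP : ℝ) (hδ_pos : 0 < δ) (hδ_le : δ ≤ Real.pi / 2)
    (hΓ_nonneg : 0 ≤ Γ) (hΓ_le : Γ ≤ Real.pi / 2) (hρP : 0 < ρP)
    (U : Set (ℝ × ℝ)) (hU_compact : IsCompact U) (hU_convex : Convex ℝ U)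
    (hU_zero : (0 : ℝ × ℝ) ∈ interior U)
    (Q : ℂ) (hQ : Q ∈ Metric.sphere (0 : ℂ) ρP) :
    ∃ γ : ℝ → ℂ,
      IsFeasiblePath U (Γ - δ / 2) (Γ + δ / 2) Q (polarPoint ρP 0) γ ∧
      pathLength γ < ⊤ ∧
      ∀ γ' : ℝ → ℂ,
        IsFeasiblePath U (Γ - δ / 2) (Γ + δ / 2) Q (polarPoint ρP 0) γ' →
        pathLength γ ≤ pathLength γ' := by
  have hpi := Real.pi_pos
  obtain ⟨ε, hε, hU⟩ := exists_box_subset hU_zero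
  have hQ' : Q = polarPoint ρP Q.arg := by
    rw [mem_sphere_zero_iff_norm] at hQ
    rw [polarPoint, ← hQ, Complex.norm_mul_exp_arg_mul_I]
  rw [hQ']
  have hmax : 0 < Real.cos (max (Γ - δ / 2) 0) :=
    Real.cos_pos_of_mem_Ioo ⟨by linarith [le_max_right (Γ - δ / 2) 0],
      max_lt (by linarith) (by linarith)⟩
  have hcos : ∀ b, Γ - δ / 2 ≤ b → b ≤ Γ + δ / 2 → |Real.cos b| ≤ Real.cos (max (Γ - δ / 2) 0) := by
    intro b hb hb'
    rcases le_total 0 (Γ - δ / 2) with h | h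
    · rw [max_eq_left h]
      refine abs_le.2 ⟨?_, Real.cos_le_cos_of_nonneg_of_le_pi h (by linarith) hb⟩
      rw [← Real.cos_pi_sub]
      exact Real.cos_le_cos_of_nonneg_of_le_pi (by linarith) (by linarith) (by linarith)
    · rw [max_eq_right h, Real.cos_zero]
      exact Real.abs_cos_le_one b
  have hcos₁ : 0 < Real.cos (Γ - δ / 2) :=
    Real.cos_pos_of_mem_Ioo ⟨by linarith, by linarith⟩
  -- The cases differ in whether the cone extends beyond the lateral direction, which would permit
  -- driving forward while moving away from the feature.
  rcases le_or_gt (Γ + δ / 2) (Real.pi / 2) with h | h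
  · exact exists_shortest_of_isExtremalPair (isExtremalPair_front hε (half_pos hδ_pos)
      (by linarith) hΓ_nonneg h) hε hU (by linarith) (by linarith) hcos₁ hmax hcos hρP
      (Complex.abs_arg_le_pi Q)
  · exact exists_shortest_of_isExtremalPair (isExtremalPair_lateral hε (half_pos hδ_pos)
      (by linarith) hΓ_nonneg hΓ_le h) hε hU (by linarith) (by linarith) hcos₁ hmax hcos hρP
      (Complex.abs_arg_le_pi Q)
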